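/- **Setting.** Let $\mathbb F_q$ be a finite field of characteristic different from $2$ and $3$, let $f=x^3+Ax+B\in\mathbb F_q[x]$ have no multiple roots, and let $E$ be the elliptic curve $y^2=f(x)$ with neutral element $P_\infty$. Let $\varphi$ be the $q$-Frobenius endomorphism of $E(\mathbb F_{q^3})$, and assume that the trace-zero subgroup $T_3=\{Q\in E(\mathbb F_{q^3}) : Q+\varphi(Q)+\varphi^2(Q)=P_\infty\}$ is cyclic of prime order $p>3$, generated by $P$. For $Q\in T_3\setminus\{P_\infty\}$ let $h_Q=y-(\alpha_1x+\alpha_0)$, with $\alpha_0,\alpha_1\in\mathbb F_q$, be the line through $Q,\varphi(Q),\varphi^2(Q)$; thus $h_{-Q}(x,y)=-h_Q(x,-y)$. For $Q,R\in T_3\setminus\{P_\infty\}$ let $$S_{Q,R}=(S_{Q,R})_1+y\,(S_{Q,R})_2=(a_4x^4+a_3x^3+a_2x^2+a_1x+a_0)+y(b_3x^3+b_2x^2+b_1x+b_0)$$ be the polynomial over $\mathbb F_q$, unique up to a nonzero constant, with divisor $\sum_{0\le i,j\le 2}(\varphi^i(Q)+\varphi^j(R))-9P_\infty$ on $E$,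 scaled so that $b_3=1$ whenever $b_3\ne0$. For $h_Q\neq h_R$ the subalgorithm computes it from the coefficients of $h_Q$ and $h_R$ by explicit formulas, in which each $a_i,b_i$ is, before scaling, an integer polynomial in $A$, $B$ and these coefficients (the formulas are spelled out in the formal definitions). For $W=x^3+w_2x^2+w_1x+w_0$ and $S=S_1+yS_2$ with coefficients $a_i,b_i$ as above, let $L(W,S)$ be the linear system in $(\gamma_1,\gamma_0)$ with augmented matrix $$\begin{pmatrix} w_0(w_2-b_2) & b_0-w_0 & w_0a_3-a_4w_2w_0-a_0\\ w_0(w_1-b_1) & b_0w_2-w_0b_2 & w_0a_2-a_4w_1w_0-a_0w_2\\ w_0(w_0-b_0) & b_0w_1-b_1w_0 & w_0a_1-a_4w_0^2-a_0w_1\end{pmatrix}.$$ "Solving $L(W,S)$" means returning $y-(\gamma_1x+\gamma_0)$ for its unique solution; the subalgorithm fails if a system that it has to solve does not have exactly one solution. **Subalgorithm.** Input: the lines $h_{m_1P},h_{m_2P},h_{n_1P},h_{n_2P}$. 1. If $h_{m_1P}=h_{m_2P}$, return $-h_{m_1P}(x,-y)$. If $h_{n_1P}=h_{n_2P}$, return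 $-h_{n_1P}(x,-y)$. 2. Compute $S_1=S_{1,1}+yS_{1,2}:=S_{m_1P,m_2P}$ and $S_2=S_{2,1}+yS_{2,2}:=S_{n_1P,n_2P}$. 3. If $h_{m_1P}(x,y)=-h_{m_2P}(x,-y)$, let $W$ be the monic multiple of $S_{1,1}$, solve $L(W,S_2)$ and return the result. If $h_{n_1P}(x,y)=-h_{n_2P}(x,-y)$, let $W$ be the monic multiple of $S_{2,1}$, solve $L(W,S_1)$ and return the result. 4. Let $G=\gcd(fS_{1,2}^2-S_{1,1}^2,\ fS_{2,2}^2-S_{2,1}^2)$ and let $W_1,\dots,W_s$ be the distinct monic irreducible factors of $G$ of degree $3$ in $\mathbb F_q[x]$, in any order. 5. For $W=W_1,\dots,W_s$ in turn: if $W\ne S_{1,2}$, solve $L(W,S_1)$ to get $h=y-(\gamma_1x+\gamma_0)$, and return $h$ if $W\mid(\gamma_1x+\gamma_0)S_{2,2}+S_{2,1}$; if $W=S_{1,2}$, solve $L(W,S_2)$ and return the result. **Theorem.** Let $m$ be an odd integer with $0<m<p$, and let $m_1,m_2,n_1,n_2$ be integers, none divisible by $p$, such that $m_1+m_2=n_1+n_2=m$,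 $m_1\not\equiv m_2$ and $n_1\not\equiv n_2 \pmod p$ (the conditions modulo $p$ hold automatically if $m_1,m_2,n_1,n_2$ are positive). For $i\in\{1,2\}$ let $h_i$ be the line $h_Q$ of the point $Q=m_1P+\varphi^i(m_2P)$ and $k_i$ the line $h_Q$ of the point $Q=n_1P+\varphi^i(n_2P)$, and assume that $h_1,h_2\notin\{k_1,k_2\}$ (a line that is undefined because its point is $P_\infty$ counts as different from all lines). Then the subalgorithm is correct: the polynomials computed in step 2, if $h_{m_1P}\neq h_{m_2P}$, respectively $h_{n_1P}\ne h_{n_2P}$, are $S_{m_1P,m_2P}$, respectively $S_{n_1P,n_2P}$; and, for every order of the factors in step 4, the subalgorithm does not fail and returns the line $h_{mP}$, which exists and is unique. -/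

import Mathlib

open Polynomial
open scoped Polynomial.Bivariate WeierstrassCurve.Affine

namespace TraceZero

noncomputable section

/-! ### The curve, the Frobenius endomorphism, and the trace-zero subgroup -/

/-- The cubic `f = x³ + A x + B`. -/
def cubic {F : Type*} [Field F] (A B : F) : F[X] := X ^ 3 + C A * X + C B

/-- The curve `y² = x³ + A x + B`. -/
def curve {F : Type*} [Field F] (A B : F) : WeierstrassCurve.Affine F :=
  { a₁ := 0, a₂ := 0, a₃ := 0, a₄ := A, a₆ := B }

section Points

variable {F L : Type*} [Field F] [Fintype F] [Field L] [Algebra F L] [DecidableEq L]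

/-- The Frobenius endomorphism `φ : (x, y) ↦ (x ^ q, y ^ q)` of `E(L)`, where `q = #F`. -/
def frob (A B : F) : ((curve A B)⁄L).Point →+ ((curve A B)⁄L).Point :=
  WeierstrassCurve.Affine.Point.map (FiniteField.frobeniusAlgHom F L)

/-- The kernel of the trace `P ↦ P + φ(P) + φ²(P)` on `E(L)`; this is the trace-zero subgroup `T₃`
when `L` has degree three over `F`. -/
def traceZero (L : Type*) [Field L] [Algebra F L] [DecidableEq L] (A B : F) :
    AddSubgroup ((curve A B)⁄L).Point :=
  AddMonoidHom.ker (AddMonoidHom.id ((curve A B)⁄L).Point + frob A B + (frob A B).comp (frob A B))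

end Points

/-! ### Lines -/

/-- The line `y - (slope * x + const) = 0`, given by its pair of coefficients. -/
@[ext]
structure Line (F : Type*) where
  slope : F
  const : F

/-- The polynomial `α₁ x + α₀` of the line `y - (α₁ x + α₀) = 0`. -/
def Line.rhs {F : Type*} [Field F] (h : Line F) : F[X] := C h.slope * X + C h.const

/-- From `h(x, y) = y - (α₁ x + α₀)` to `-h(x, -y) = y + (α₁ x + α₀)`. -/
def Line.neg {F : Type*} [Field F] (h : Line F) : Line F := ⟨-h.slope, -h.const⟩

section LineOf

variable {F L : Type*} [Field F] [Fintype F] [Field L] [Algebra F L] [DecidableEq L]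

/-- The (affine) point lies on the line. -/
def Line.Contains {A B : F} (h : Line F) : ((curve A B)⁄L).Point → Prop
  | .zero => False
  | .some x y _ => y = algebraMap F L h.slope * x + algebraMap F L h.const

/-- `h` is the line `h_Q` through `Q`, `φ(Q)`, `φ²(Q)`.  It never holds for `Q = P_∞`. -/
def IsLineOf {A B : F} (h : Line F) (Q : ((curve A B)⁄L).Point) : Prop :=
  h.Contains Q ∧ h.Contains (frob A B Q) ∧ h.Contains (frob A B (frob A B Q))

end LineOf

/-! ### The polynomials `S_{P,Q} = (S_{P,Q})₁ + y (S_{P,Q})₂` -/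

section Divisor

variable {F L : Type*} [Field F] [Fintype F] [Field L] [Algebra F L] [DecidableEq L]

/-- The prime ideal of the affine coordinate ring at an affine point, and the unit ideal at `P_∞`. -/
def pointIdeal {A B : F} : ((curve A B)⁄L).Point → Ideal ((curve A B)⁄L).CoordinateRing
  | .zero => ⊤
  | .some x y _ => WeierstrassCurve.Affine.CoordinateRing.XYIdeal ((curve A B)⁄L) x (C y)

/-- The function on the curve over `L` given by a polynomial `S.1 + y * S.2` over `F`. -/
def toFunction (L : Type*) [Field L] [Algebra F L] (A B : F) (S : F[X] × F[X]) :
    ((curve A B)⁄L).CoordinateRing :=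
  WeierstrassCurve.Affine.CoordinateRing.mk ((curve A B)⁄L)
    (C (S.1.map (algebraMap F L)) + Y * C (S.2.map (algebraMap F L)))

/-- `S = S.1 + y * S.2` is a polynomial `S_{P,Q}`: its divisor on the curve is
`∑_{0 ≤ i, j ≤ 2} (φⁱ(P) + φʲ(Q)) - 9 P_∞`.  Divisors of functions have degree zero, so that it is
enough to compare the zeros outside `P_∞`, which is an equality of ideals of the affine
coordinate ring. -/
def IsS {A B : F} (S : F[X] × F[X]) (P Q : ((curve A B)⁄L).Point) : Prop :=
  Ideal.span {toFunction L A B S} =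
    ∏ i : Fin 3, ∏ j : Fin 3,
      pointIdeal ((frob A B)^[(i : ℕ)] P + (frob A B)^[(j : ℕ)] Q)

end Divisor

section Formulas

/-! Explicit formulas for the coefficients of `S_{P,Q}`, up to a common factor, in terms of
`h_P = y - (α₁ x + α₀)` and `h_Q = y - (β₁ x + β₀)`. -/

variable {F : Type*} [Field F]

/-- The coefficient `a4` of `x^4`. -/
def sCoeffA4 (A B α₁ α₀ β₁ β₀ : F) : F :=
  -α₁^3 * β₁ * β₀^2 - 3 * B * α₁^3 * β₁ + 2 * A * α₁^3 * β₀ + 2 * α₁^2 * α₀ * β₁^2 * β₀ + A *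
    α₁^2 * α₀ * β₁ - 6 * B * α₁^2 * β₁^2 + 3 * A * α₁^2 * β₁ * β₀ + A^2 * α₁^2 - α₁ * α₀^2 *
    β₁^3 + 6 * α₁ * α₀^2 * β₀ + 3 * A * α₁ * α₀ * β₁^2 + 3 * α₁ * α₀ * β₀^2 + 9 * B * α₁ * α₀ -
    3 * B * α₁ * β₁^3 + A * α₁ * β₁^2 * β₀ + 2 * A^2 * α₁ * β₁ - 3 * α₁ * β₀^3 + 9 * B * α₁ * β₀
    - 3 * α₀^3 * β₁ + 3 * α₀^2 * β₁ * β₀ - 3 * A * α₀^2 + 2 * A * α₀ * β₁^3 + 6 * α₀ * β₁ * β₀^2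
    + 9 * B * α₀ * β₁ - 6 * A * α₀ * β₀ + A^2 * β₁^2 + 9 * B * β₁ * β₀ - 3 * A * β₀^2

/-- The coefficient `a3` of `x^3`. -/
def sCoeffA3 (A B α₁ α₀ β₁ β₀ : F) : F :=
  4 * B * α₁^3 * β₁^3 - 2 * A * α₁^3 * β₁^2 * β₀ + A^2 * α₁^3 * β₁ - α₁^3 * β₀^3 + 9 * B * α₁^3
    * β₀ - 2 * A * α₁^2 * α₀ * β₁^3 - α₁^2 * α₀ * β₁ * β₀^2 + 3 * B * α₁^2 * α₀ * β₁ - 7 * A *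
    α₁^2 * α₀ * β₀ + A^2 * α₁^2 * β₁^2 - 6 * B * α₁^2 * β₁ * β₀ + 3 * A * α₁^2 * β₀^2 + 6 * A *
    B * α₁^2 - α₁ * α₀^2 * β₁^2 * β₀ + A * α₁ * α₀^2 * β₁ - 6 * B * α₁ * α₀ * β₁^2 + 12 * A * α₁
    * α₀ * β₁ * β₀ - 8 * A^2 * α₁ * α₀ + A^2 * α₁ * β₁^3 + 3 * B * α₁ * β₁^2 * β₀ + A * α₁ * β₁
    * β₀^2 - 6 * A * B * α₁ * β₁ + 4 * A^2 * α₁ * β₀ - α₀^3 * β₁^3 - 3 * α₀^3 * β₀ + 3 * A *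
    α₀^2 * β₁^2 + 21 * α₀^2 * β₀^2 - 18 * B * α₀^2 + 9 * B * α₀ * β₁^3 - 7 * A * α₀ * β₁^2 * β₀
    + 4 * A^2 * α₀ * β₁ - 3 * α₀ * β₀^3 + 18 * B * α₀ * β₀ + 6 * A * B * β₁^2 - 8 * A^2 * β₁ *
    β₀ - 18 * B * β₀^2 + 4 * A^3 + 27 * B^2

/-- The coefficient `a2` of `x^2`. -/
def sCoeffA2 (A B α₁ α₀ β₁ β₀ : F) : F :=
  -A^2 * α₁^3 * β₁^3 - 2 * A * α₁^3 * β₁ * β₀^2 - 6 * A * B * α₁^3 * β₁ + A^2 * α₁^3 * β₀ - 2 *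
    A * α₁^2 * α₀ * β₁^2 * β₀ + 5 * A^2 * α₁^2 * α₀ * β₁ - 3 * α₁^2 * α₀ * β₀^3 - 9 * B * α₁^2 *
    α₀ * β₀ + 6 * A * B * α₁^2 * β₁^2 + 9 * B * α₁^2 * β₀^2 + (2 * A^3 + 27 * B^2) * α₁^2 - 2 *
    A * α₁ * α₀^2 * β₁^3 - 3 * α₁ * α₀^2 * β₁ * β₀^2 + 9 * B * α₁ * α₀^2 * β₁ + 9 * A * α₁ *
    α₀^2 * β₀ + 36 * B * α₁ * α₀ * β₁ * β₀ - 12 * A * α₁ * α₀ * β₀^2 - 18 * A * B * α₁ * α₀ - 6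
    * A * B * α₁ * β₁^3 + 5 * A^2 * α₁ * β₁^2 * β₀ + 9 * B * α₁ * β₁ * β₀^2 + (4 * A^3 - 27 *
    B^2) * α₁ * β₁ - 3 * A * α₁ * β₀^3 + 36 * A * B * α₁ * β₀ - 3 * α₀^3 * β₁^2 * β₀ - 3 * A *
    α₀^3 * β₁ + 9 * B * α₀^2 * β₁^2 - 12 * A * α₀^2 * β₁ * β₀ + 6 * A^2 * α₀^2 + A^2 * α₀ * β₁^3
    - 9 * B * α₀ * β₁^2 * β₀ + 9 * A * α₀ * β₁ * β₀^2 + 36 * A * B * α₀ * β₁ - 24 * A^2 * α₀ *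
    β₀ + (2 * A^3 + 27 * B^2) * β₁^2 - 18 * A * B * β₁ * β₀ + 6 * A^2 * β₀^2

/-- The coefficient `a1` of `x^1`. -/
def sCoeffA1 (A B α₁ α₀ β₁ β₀ : F) : F :=
  -A^2 * α₁^3 * β₁^2 * β₀ - 4 * B * α₁^3 * β₁ * β₀^2 + (A^3 - 12 * B^2) * α₁^3 * β₁ + 8 * A * B
    * α₁^3 * β₀ - A^2 * α₁^2 * α₀ * β₁^3 - 4 * B * α₁^2 * α₀ * β₁^2 * β₀ + 16 * A * B * α₁^2 *
    α₀ * β₁ - 3 * A^2 * α₁^2 * α₀ * β₀ + (-3 * A^3 + 12 * B^2) * α₁^2 * β₁^2 - 24 * A * B * α₁^2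
    * β₁ * β₀ + 3 * A^2 * α₁^2 * β₀^2 - 2 * A^2 * B * α₁^2 - 4 * B * α₁ * α₀^2 * β₁^3 - 3 * A^2
    * α₁ * α₀^2 * β₁ - 3 * α₁ * α₀^2 * β₀^3 + 15 * B * α₁ * α₀^2 * β₀ - 24 * A * B * α₁ * α₀ *
    β₁^2 + 12 * A^2 * α₁ * α₀ * β₁ * β₀ - 6 * B * α₁ * α₀ * β₀^2 - 18 * B^2 * α₁ * α₀ + (A^3 -
    12 * B^2) * α₁ * β₁^3 + 16 * A * B * α₁ * β₁^2 * β₀ - 3 * A^2 * α₁ * β₁ * β₀^2 + 14 * A^2 *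
    B * α₁ * β₁ - 3 * B * α₁ * β₀^3 + 63 * B^2 * α₁ * β₀ - 3 * α₀^3 * β₁ * β₀^2 - 3 * B * α₀^3 *
    β₁ - 3 * A * α₀^3 * β₀ + 3 * A^2 * α₀^2 * β₁^2 - 6 * B * α₀^2 * β₁ * β₀ + 9 * A * α₀^2 *
    β₀^2 + 6 * A * B * α₀^2 + 8 * A * B * α₀ * β₁^3 - 3 * A^2 * α₀ * β₁^2 * β₀ + 15 * B * α₀ *
    β₁ * β₀^2 + 63 * B^2 * α₀ * β₁ - 3 * A * α₀ * β₀^3 - 42 * A * B * α₀ * β₀ - 2 * A^2 * B *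
    β₁^2 - 18 * B^2 * β₁ * β₀ + 6 * A * B * β₀^2 + 4 * A^4 + 27 * A * B^2

/-- The coefficient `a0` of `x^0`. -/
def sCoeffA0 (A B α₁ α₀ β₁ β₀ : F) : F :=
  2 * A^2 * B * α₁^3 * β₁ - A^3 * α₁^3 * β₀ - A^2 * α₁^2 * α₀ * β₁^2 * β₀ - 4 * B * α₁^2 * α₀ *
    β₁ * β₀^2 + 12 * B^2 * α₁^2 * α₀ * β₁ - 4 * A * B * α₁^2 * α₀ * β₀ - 5 * A^2 * B * α₁^2 *
    β₁^2 + (A^3 - 24 * B^2) * α₁^2 * β₁ * β₀ + 6 * A * B * α₁^2 * β₀^2 + (A^4 + 6 * A * B^2) *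
    α₁^2 - 4 * B * α₁ * α₀^2 * β₁^2 * β₀ + 2 * A * α₁ * α₀^2 * β₁ * β₀^2 - 2 * A * B * α₁ * α₀^2
    * β₁ - A^2 * α₁ * α₀^2 * β₀ + (A^3 - 24 * B^2) * α₁ * α₀ * β₁^2 + 24 * A * B * α₁ * α₀ * β₁
    * β₀ - 3 * A^2 * α₁ * α₀ * β₀^2 + A^2 * B * α₁ * α₀ + 2 * A^2 * B * α₁ * β₁^3 + 12 * B^2 *
    α₁ * β₁^2 * β₀ - 2 * A * B * α₁ * β₁ * β₀^2 + (-2 * A^4 - 6 * A * B^2) * α₁ * β₁ - 5 * A^2 *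
    B * α₁ * β₀ - α₀^3 * β₀^3 - 3 * B * α₀^3 * β₀ + 6 * A * B * α₀^2 * β₁^2 - 3 * A^2 * α₀^2 *
    β₁ * β₀ + 3 * B * α₀^2 * β₀^2 + (A^3 + 9 * B^2) * α₀^2 - A^3 * α₀ * β₁^3 - 4 * A * B * α₀ *
    β₁^2 * β₀ - A^2 * α₀ * β₁ * β₀^2 - 5 * A^2 * B * α₀ * β₁ - 3 * B * α₀ * β₀^3 + (2 * A^3 - 9
    * B^2) * α₀ * β₀ + (A^4 + 6 * A * B^2) * β₁^2 + A^2 * B * β₁ * β₀ + (A^3 + 9 * B^2) * β₀^2 +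
    4 * A^3 * B + 27 * B^3

/-- The coefficient `b3` of `y x^3`. -/
def sCoeffB3 (A B α₁ α₀ β₁ β₀ : F) : F :=
  α₁^3 * β₀^2 - B * α₁^3 - 2 * α₁^2 * α₀ * β₁ * β₀ + A * α₁^2 * α₀ + α₁^2 * β₁ * β₀^2 - 3 * B *
    α₁^2 * β₁ + A * α₁^2 * β₀ + α₁ * α₀^2 * β₁^2 - 2 * α₁ * α₀ * β₁^2 * β₀ + 2 * A * α₁ * α₀ *
    β₁ - 3 * B * α₁ * β₁^2 + 2 * A * α₁ * β₁ * β₀ + α₀^3 + α₀^2 * β₁^3 + 3 * α₀^2 * β₀ + A * α₀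
    * β₁^2 + 3 * α₀ * β₀^2 - B * β₁^3 + A * β₁^2 * β₀ + β₀^3

/-- The coefficient `b2` of `y x^2`. -/
def sCoeffB2 (A B α₁ α₀ β₁ β₀ : F) : F :=
  A^2 * α₁^3 + 3 * α₁^2 * α₀ * β₀^2 + 9 * B * α₁^2 * α₀ + 3 * A^2 * α₁^2 * β₁ + 3 * α₁^2 * β₀^3
    + 9 * B * α₁^2 * β₀ - 6 * α₁ * α₀^2 * β₁ * β₀ - 3 * A * α₁ * α₀^2 - 6 * α₁ * α₀ * β₁ * β₀^2
    + 18 * B * α₁ * α₀ * β₁ - 6 * A * α₁ * α₀ * β₀ + 3 * A^2 * α₁ * β₁^2 + 18 * B * α₁ * β₁ * β₀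
    - 3 * A * α₁ * β₀^2 + 3 * α₀^3 * β₁^2 + 3 * α₀^2 * β₁^2 * β₀ - 3 * A * α₀^2 * β₁ + 9 * B *
    α₀ * β₁^2 - 6 * A * α₀ * β₁ * β₀ + A^2 * β₁^3 + 9 * B * β₁^2 * β₀ - 3 * A * β₁ * β₀^2

/-- The coefficient `b1` of `y x^1`. -/
def sCoeffB1 (A B α₁ α₀ β₁ β₀ : F) : F :=
  -A^2 * α₁^3 * β₁^2 - 2 * A * α₁^3 * β₀^2 + 2 * A * B * α₁^3 - 12 * B * α₁^2 * α₀ * β₁^2 + 4 *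
    A * α₁^2 * α₀ * β₁ * β₀ - 3 * A^2 * α₁^2 * α₀ - A^2 * α₁^2 * β₁^3 - 12 * B * α₁^2 * β₁^2 *
    β₀ + 4 * A * α₁^2 * β₁ * β₀^2 + A^2 * α₁^2 * β₀ + 4 * A * α₁ * α₀^2 * β₁^2 - 3 * α₁ * α₀^2 *
    β₀^2 - 9 * B * α₁ * α₀^2 + 4 * A * α₁ * α₀ * β₁^2 * β₀ + 2 * A^2 * α₁ * α₀ * β₁ + 6 * α₁ *
    α₀ * β₀^3 + 18 * B * α₁ * α₀ * β₀ + 2 * A^2 * α₁ * β₁ * β₀ + 9 * B * α₁ * β₀^2 + (4 * A^3 +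
    27 * B^2) * α₁ + 6 * α₀^3 * β₁ * β₀ + A * α₀^3 - 2 * A * α₀^2 * β₁^3 - 3 * α₀^2 * β₁ * β₀^2
    + 9 * B * α₀^2 * β₁ - 9 * A * α₀^2 * β₀ + A^2 * α₀ * β₁^2 + 18 * B * α₀ * β₁ * β₀ - 9 * A *
    α₀ * β₀^2 + 2 * A * B * β₁^3 - 3 * A^2 * β₁^2 * β₀ - 9 * B * β₁ * β₀^2 + (4 * A^3 + 27 *
    B^2) * β₁ + A * β₀^3

/-- The coefficient `b0` of `y x^0`. -/
def sCoeffB0 (A B α₁ α₀ β₁ β₀ : F) : F :=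
  -2 * A^2 * α₁^3 * β₁ * β₀ - 8 * B * α₁^3 * β₀^2 + (A^3 + 8 * B^2) * α₁^3 + A^2 * α₁^2 * α₀ *
    β₁^2 - 8 * B * α₁^2 * α₀ * β₁ * β₀ + 6 * A * α₁^2 * α₀ * β₀^2 - 2 * A * B * α₁^2 * α₀ + A^2
    * α₁^2 * β₁^2 * β₀ + 4 * B * α₁^2 * β₁ * β₀^2 + (-A^3 - 12 * B^2) * α₁^2 * β₁ + 4 * A * B *
    α₁^2 * β₀ + 4 * B * α₁ * α₀^2 * β₁^2 + A^2 * α₁ * α₀^2 - 2 * A^2 * α₁ * α₀ * β₁^3 - 8 * B *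
    α₁ * α₀ * β₁^2 * β₀ + 8 * A * B * α₁ * α₀ * β₁ - 6 * A^2 * α₁ * α₀ * β₀ + (-A^3 - 12 * B^2)
    * α₁ * β₁^2 + 8 * A * B * α₁ * β₁ * β₀ - 3 * A^2 * α₁ * β₀^2 + 3 * α₀^3 * β₀^2 + B * α₀^3 -
    8 * B * α₀^2 * β₁^3 + 6 * A * α₀^2 * β₁^2 * β₀ - 3 * A^2 * α₀^2 * β₁ + 3 * α₀^2 * β₀^3 - 15
    * B * α₀^2 * β₀ + 4 * A * B * α₀ * β₁^2 - 6 * A^2 * α₀ * β₁ * β₀ - 15 * B * α₀ * β₀^2 + (4 *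
    A^3 + 27 * B^2) * α₀ + (A^3 + 8 * B^2) * β₁^3 - 2 * A * B * β₁^2 * β₀ + A^2 * β₁ * β₀^2 + B
    * β₀^3 + (4 * A^3 + 27 * B^2) * β₀

/-- `S_{P,Q}`, from the lines `h_P`, `h_Q`, by the explicit formulas. -/
def sRaw (A B : F) (h k : Line F) : F[X] × F[X] :=
  (C (sCoeffA4 A B h.slope h.const k.slope k.const) * X ^ 4
    + C (sCoeffA3 A B h.slope h.const k.slope k.const) * X ^ 3
    + C (sCoeffA2 A B h.slope h.const k.slope k.const) * X ^ 2
    + C (sCoeffA1 A B h.slope h.const k.slope k.const) * X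
    + C (sCoeffA0 A B h.slope h.const k.slope k.const),
   C (sCoeffB3 A B h.slope h.const k.slope k.const) * X ^ 3
    + C (sCoeffB2 A B h.slope h.const k.slope k.const) * X ^ 2
    + C (sCoeffB1 A B h.slope h.const k.slope k.const) * X
    + C (sCoeffB0 A B h.slope h.const k.slope k.const))

open Classical in
/-- `S_{P,Q}`, from the lines `h_P`, `h_Q`, scaled to `b₃ = 1` whenever `b₃ ≠ 0`. -/
def sPoly (A B : F) (h k : Line F) : F[X] × F[X] :=
  let S := sRaw A B h k
  if S.2.coeff 3 = 0 then S else (C (S.2.coeff 3)⁻¹ * S.1, C (S.2.coeff 3)⁻¹ * S.2)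

end Formulas

/-! ### The subalgorithm -/

section Algorithm

variable {F : Type*} [Field F]

/-- The norm `Σ = f S₂² - S₁²` of `S = S₁ + y S₂`. -/
def sigma (A B : F) (S : F[X] × F[X]) : F[X] := cubic A B * S.2 ^ 2 - S.1 ^ 2

/-- The monic scalar multiple of a nonzero polynomial. -/
def monicOf (g : F[X]) : F[X] := C g.leadingCoeff⁻¹ * g

/-- The augmented matrix `L(W, S)`, where `W = x³ + w₂ x² + w₁ x + w₀` and
`S = (a₄ x⁴ + a₃ x³ + a₂ x² + a₁ x + a₀) + y (x³ + b₂ x² + b₁ x + b₀)`. -/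
def linSys (W : F[X]) (S : F[X] × F[X]) : Matrix (Fin 3) (Fin 3) F :=
  let w := W.coeff
  let a := S.1.coeff
  let b := S.2.coeff
  !![w 0 * (w 2 - b 2), b 0 - w 0, w 0 * a 3 - a 4 * w 2 * w 0 - a 0;
     w 0 * (w 1 - b 1), b 0 * w 2 - w 0 * b 2, w 0 * a 2 - a 4 * w 1 * w 0 - a 0 * w 2;
     w 0 * (w 0 - b 0), b 0 * w 1 - b 1 * w 0, w 0 * a 1 - a 4 * w 0 ^ 2 - a 0 * w 1]

/-- `(γ₁, γ₀)` solves the linear system with the given augmented matrix. -/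
def Solves (M : Matrix (Fin 3) (Fin 3) F) (h : Line F) : Prop :=
  ∀ i, M i 0 * h.slope + M i 1 * h.const = M i 2

open Classical in
/-- Solve a linear system for the line `y - (γ₁ x + γ₀)`; fails unless there is exactly one
solution. -/
def solve (M : Matrix (Fin 3) (Fin 3) F) : Option (Line F) :=
  if e : ∃! h : Line F, Solves M h then some e.choose else none

open Classical in
/-- The monic distinct irreducible factors of degree three of `G`. -/
def cubicFactors (G : F[X]) : Finset F[X] :=
  (UniqueFactorizationMonoid.normalizedFactors G).toFinset.filter fun W => W.natDegree = 3

open Classical in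
/-- The `for` loop, over the list of the remaining cubic factors.  The result `none` means that a
linear system could not be solved uniquely or that the loop ended without returning a line. -/
def factorLoop (S₁ S₂ : F[X] × F[X]) : List F[X] → Option (Line F)
  | [] => none
  | W :: Ws =>
    if W ≠ S₁.2 then
      match solve (linSys W S₁) with
      | none => none
      | some h => if W ∣ h.rhs * S₂.2 + S₂.1 then some h else factorLoop S₁ S₂ Ws
    else
      solve (linSys W S₂)

open Classical in
/-- The subalgorithm.  The input lines are `h₁ = h_{m₁P}`, `h₂ = h_{m₂P}`, `k₁ = h_{n₁P}`,
`k₂ = h_{n₂P}`; `order` lists the cubic factors in the order in which the loop runs through them. -/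
def subalgorithm (A B : F) (order : Finset F[X] → List F[X]) (h₁ h₂ k₁ k₂ : Line F) :
    Option (Line F) :=
  if h₁ = h₂ then some h₁.neg
  else if k₁ = k₂ then some k₁.neg
  else
    let S₁ := sPoly A B h₁ h₂
    let S₂ := sPoly A B k₁ k₂
    if h₁ = h₂.neg then solve (linSys (monicOf S₁.1) S₂)
    else if k₁ = k₂.neg then solve (linSys (monicOf S₂.1) S₁)
    else
      let G := EuclideanDomain.gcd (sigma A B S₁) (sigma A B S₂)
      factorLoop S₁ S₂ (order (cubicFactors G))

end Algorithm

end

end TraceZero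

/-! If `Q ≠ 0` has trace zero, then `Q`, `φ(Q)`, `φ²(Q)` sum to `P_∞`, so they are collinear, and
the line through them is defined over `F_q` (`exists_isLineOf`). Since `T₃` has no 2- or 3-torsion,
their `x`-coordinates are distinct and not in `F_q`. Hence a line determines the Frobenius orbit of
its points, and the cubic `f - (α₁x + α₀)²` of the line `h_Q` is the minimal polynomial of `x(Q)`;
it does not change when `Q` is replaced by `-Q`.

The formulas for `S_{Q,R}`: the line through `-φⁱ(Q)` and `-φʲ(R)` meets the curve again in `φⁱ(Q) +
φʲ(R)`. The product of these nine lines therefore has the divisor of `(h_{-Q} h_{-R})³ S_{Q,R}`. The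
same product is, up to powers of the two lines, a resultant of two cubics in the slope; Bézout's
determinant evaluates it to a constant times the explicit polynomial (`prod_prod_lineDet`). The
constant is nonzero for `h_Q ≠ h_R`, and cancelling the lines gives `isS_sRaw`.

Reading points off `S`: for a line `h_Z = y - r(x)` with cubic `W`, the divisibility `W ∣ r S₂ + S₁`
says that `S` vanishes at `Z`, that is, `Z = φⁱ(Q) + φʲ(R)` for some `i, j`
(`LineOrbit.cubic_dvd_iff_exists`). Every irreducible factor of the norm arises from such a `Z`
(`IsS.exists_cubic_eq`). The system `L(W, S)` spells out the divisibility, and its solution is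
unique unless `W ∣ S₂` (`solve_linSys`).

Correctness: up to conjugation the zeros of `S_{Q,R}` are `Q + φᵈ(R)` with `d = 0, 1, 2`, so by
genericity the orbit of `mP` is the only one common to both polynomials (`eq_of_common_zero`). If
`W` is the cubic of `h_{mP}` and divides the `y`-part of one polynomial, that polynomial vanishes at
`-mP` as well. This cannot happen for both, as `-mP` would be a second common zero; so one of the
two systems always determines `h_{mP}`. -/

namespace TraceZero

noncomputable section

/-! ### The resultant identity behind the explicit formulas -/

/-- Bézout's determinant for the resultant of two cubics, given by their coefficients. -/
def bezoutDet {R : Type*} [CommRing R] (p q : Fin 4 → R) : R :=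
  let b := fun i j => p j * q i - p i * q j
  Matrix.det !![b 1 0, b 2 0, b 3 0; b 2 0, b 3 0 + b 2 1, b 3 1; b 3 0, b 3 1, b 3 2]

/-- The second argument lists the coefficients of `∏ (nᵢ - dᵢ T)`, whose roots are `nᵢ / dᵢ`, and `P
n d` is `d³ p(n / d)`. The homogeneous form avoids dividing by `dᵢ`. -/
theorem prod_cubic_eq_bezoutDet {R : Type*} [CommRing R] (p : Fin 4 → R)
    (n₁ n₂ n₃ d₁ d₂ d₃ : R) :
    let P := fun n d => p 0 * d ^ 3 + p 1 * d ^ 2 * n + p 2 * d * n ^ 2 + p 3 * n ^ 3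
    P n₁ d₁ * P n₂ d₂ * P n₃ d₃ =
      bezoutDet p ![n₁ * n₂ * n₃, -(n₁ * n₂ * d₃ + n₁ * d₂ * n₃ + d₁ * n₂ * n₃),
        n₁ * d₂ * d₃ + d₁ * n₂ * d₃ + d₁ * d₂ * n₃, -(d₁ * d₂ * d₃)] := by
  simp [bezoutDet, Matrix.det_fin_three]
  ring

theorem bezoutDet_smul {R : Type*} [CommRing R] (p q : Fin 4 → R) (t : R) :
    bezoutDet p (fun i => t * q i) = t ^ 3 * bezoutDet p q := by
  simp [bezoutDet, Matrix.det_fin_three]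
  ring

/-- The coefficients of the cubic whose roots are the slopes of the lines through `(x, y)` and one
of the intersection points of the curve with `y = -(α₁ x + α₀)`. -/
def slopeCubic {R : Type*} [CommRing R] (A x y α₁ α₀ : R) : Fin 4 → R :=
  let g := y + α₁ * x + α₀
  let c₁ := g * (α₁ ^ 2 - 3 * x)
  let c₂ := 3 * x ^ 2 + A - 2 * α₁ * (α₁ * x + α₀)
  let c₃ := α₁ * x + α₀ - y
  ![g ^ 2 + c₁ * α₁ + c₂ * α₁ ^ 2 + c₃ * α₁ ^ 3, c₁ + 2 * c₂ * α₁ + 3 * c₃ * α₁ ^ 2,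
    c₂ + 3 * c₃ * α₁, c₃]

/-- Reduction modulo the curve equation makes every coefficient linear in `y`. -/
theorem slopeCubic_eq {R : Type*} [CommRing R] {A B x y α₁ α₀ : R}
    (h : y ^ 2 = x ^ 3 + A * x + B) :
    slopeCubic A x y α₁ α₀ =
      ![x ^ 3 + A * x + B + α₁ ^ 2 * x ^ 2 - α₁ * α₀ * x + α₀ ^ 2 + A * α₁ ^ 2
          + y * (2 * α₀ - α₁ * x),
        3 * α₁ * x ^ 2 - 3 * α₀ * x + 2 * A * α₁ + y * (-2 * α₁ ^ 2 - 3 * x),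
        3 * x ^ 2 + A + α₁ ^ 2 * x + α₁ * α₀ + y * (-3 * α₁), α₁ * x + α₀ - y] := by
  funext i
  fin_cases i <;> simp [slopeCubic]
  · linear_combination h
  · ring
  · ring

/-- Splitting the determinant into its even and odd part in `y` leaves two identities in `x` alone,
which are to match `S₁` and `S₂` separately. -/
theorem det_symm_add_smul {R : Type*} [CommRing R] {y f : R} (h : y ^ 2 = f) (u v : Fin 6 → R) :
    Matrix.det !![u 0 + y * v 0, u 1 + y * v 1, u 2 + y * v 2;
        u 1 + y * v 1, u 3 + y * v 3, u 4 + y * v 4;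
        u 2 + y * v 2, u 4 + y * v 4, u 5 + y * v 5] =
      (u 0 * (u 3 * u 5 - u 4 ^ 2 + f * (v 3 * v 5 - v 4 ^ 2))
        - u 1 * (u 1 * u 5 - u 2 * u 4 + f * (v 1 * v 5 - v 2 * v 4))
        + u 2 * (u 1 * u 4 - u 2 * u 3 + f * (v 1 * v 4 - v 2 * v 3))
        + f * (v 0 * (u 3 * v 5 + v 3 * u 5 - 2 * u 4 * v 4)
          - v 1 * (u 1 * v 5 + v 1 * u 5 - u 2 * v 4 - v 2 * u 4)
          + v 2 * (u 1 * v 4 + v 1 * u 4 - u 2 * v 3 - v 2 * u 3)))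
      + y * (v 0 * (u 3 * u 5 - u 4 ^ 2 + f * (v 3 * v 5 - v 4 ^ 2))
        - v 1 * (u 1 * u 5 - u 2 * u 4 + f * (v 1 * v 5 - v 2 * v 4))
        + v 2 * (u 1 * u 4 - u 2 * u 3 + f * (v 1 * v 4 - v 2 * v 3))
        + u 0 * (u 3 * v 5 + v 3 * u 5 - 2 * u 4 * v 4)
        - u 1 * (u 1 * v 5 + v 1 * u 5 - u 2 * v 4 - v 2 * u 4)
        + u 2 * (u 1 * v 4 + v 1 * u 4 - u 2 * v 3 - v 2 * u 3)) := by
  subst h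
  simp only [Matrix.det_fin_three, Matrix.of_apply, Matrix.cons_val]
  ring

/-- The even part, in `y`, of the entries of Bézout's matrix for the slope cubics of two lines with
slopes `s ± d` and constants `t ± e`. -/
def bezoutEven {R : Type*} [CommRing R] (A B x s d t e : R) : Fin 6 → R :=
  ![
    (2 * s ^ 2 * d - 2 * d ^ 3 - 6 * e) * x ^ 4 + (-4 * A * d - 8 * s ^ 2 * e + 4 * s * t * d + 4
    * d ^ 2 * e) * x ^ 3 + (6 * A * s ^ 2 * d - 6 * A * d ^ 3 - 6 * A * e + 12 * s * t * e - 12 *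
    d * e ^ 2) * x ^ 2 + (-4 * A ^ 2 * d - 6 * A * s ^ 2 * e + 4 * A * s * t * d + 2 * A * d ^ 2
    * e - 4 * B * s ^ 2 * d + 4 * B * d ^ 3 - 6 * B * e - 6 * t ^ 2 * e + 6 * e ^ 3) * x + 4 * A
    ^ 2 * s ^ 2 * d - 4 * A ^ 2 * d ^ 3 - 4 * A * B * d + 8 * A * s * t * e - 4 * A * t ^ 2 * d -
    4 * A * d * e ^ 2 - 8 * B * s ^ 2 * e + 16 * B * s * t * d - 8 * B * d ^ 2 * e,
    8 * s * d * x ^ 4 + (-20 * s * e + 4 * t * d) * x ^ 3 + (12 * A * s * d - 4 * s ^ 3 * e + 4 *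
    s ^ 2 * t * d + 4 * s * d ^ 2 * e - 4 * t * d ^ 3 + 12 * t * e) * x ^ 2 + (-16 * A * s * e +
    8 * A * t * d - 4 * B * s * d + 4 * s ^ 2 * t * e - 4 * s * t ^ 2 * d - 4 * s * d * e ^ 2 + 4
    * t * d ^ 2 * e) * x + 4 * A ^ 2 * s * d - 2 * A * s ^ 3 * e + 2 * A * s ^ 2 * t * d + 2 * A
    * s * d ^ 2 * e - 2 * A * t * d ^ 3 + 4 * A * t * e - 14 * B * s * e + 10 * B * t * d + 2 * s
    * t ^ 2 * e - 2 * s * e ^ 3 - 2 * t ^ 3 * d + 2 * t * d * e ^ 2,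
    (2 * s ^ 2 * d - 2 * d ^ 3 - 6 * e) * x ^ 3 + (-4 * s ^ 2 * e + 4 * s * t * d) * x ^ 2 + (2 *
    A * s ^ 2 * d - 2 * A * d ^ 3 - 6 * A * e + 4 * s * t * e - 4 * t ^ 2 * d) * x - 2 * A * s ^
    2 * e + 4 * A * s * t * d - 2 * A * d ^ 2 * e - 6 * B * e + 2 * t ^ 2 * e - 2 * e ^ 3,
    (8 * s ^ 2 * d - 8 * d ^ 3 - 24 * e) * x ^ 3 + (-16 * s ^ 2 * e + 16 * s * t * d) * x ^ 2 +
    (10 * A * s ^ 2 * d - 10 * A * d ^ 3 - 12 * A * e - 18 * B * d + 4 * s * t * e + 2 * t ^ 2 *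
    d - 6 * d * e ^ 2) * x + 4 * A ^ 2 * d - 6 * A * s ^ 2 * e + 4 * A * s * t * d + 2 * A * d ^
    2 * e + 12 * B * s ^ 2 * d - 12 * B * d ^ 3 - 6 * B * e + 2 * t ^ 2 * e - 2 * e ^ 3,
    8 * s * d * x ^ 3 + (-12 * s * e + 12 * t * d) * x ^ 2 + 8 * A * s * d * x - 4 * A * s * e +
    4 * A * t * d + 8 * B * s * d,
    (2 * s ^ 2 * d - 2 * d ^ 3 - 6 * e) * x ^ 2 + (4 * A * d + 4 * s * t * d - 4 * d ^ 2 * e) * x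
    - 2 * A * e + 6 * B * d + 2 * t ^ 2 * d - 2 * d * e ^ 2]

/-- The odd part, in `y`, of the entries of Bézout's matrix for the slope cubics of two lines with
slopes `s ± d` and constants `t ± e`. -/
def bezoutOdd {R : Type*} [CommRing R] (A B x s d t e : R) : Fin 6 → R :=
  ![
    -4 * s * d * x ^ 3 + 12 * s * e * x ^ 2 + (-4 * A * s * d + 4 * s ^ 3 * e - 4 * s ^ 2 * t * d
    - 4 * s * d ^ 2 * e + 4 * t * d ^ 3 - 12 * t * e) * x + 8 * A * s * e - 8 * A * t * d + 8 * B
    * s * d - 8 * s ^ 2 * t * e + 8 * s * t ^ 2 * d + 8 * s * d * e ^ 2 - 8 * t * d ^ 2 * e,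
    (-4 * s ^ 2 * d + 4 * d ^ 3 + 12 * e) * x ^ 2 + (4 * A * d + 12 * s ^ 2 * e - 8 * s * t * d -
    4 * d ^ 2 * e) * x - 6 * A * s ^ 2 * d + 6 * A * d ^ 3 + 4 * A * e + 6 * B * d - 12 * s * t *
    e + 2 * t ^ 2 * d + 10 * d * e ^ 2,
    -4 * s * d * x ^ 2 + (8 * s * e - 4 * t * d) * x - 4 * A * s * d - 4 * t * e,
    -16 * s * d * x ^ 2 + (32 * s * e - 16 * t * d) * x - 12 * A * s * d + 4 * s ^ 3 * e - 4 * s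
    ^ 2 * t * d - 4 * s * d ^ 2 * e + 4 * t * d ^ 3 - 4 * t * e,
    (-4 * s ^ 2 * d + 4 * d ^ 3 + 12 * e) * x - 4 * A * d + 4 * s ^ 2 * e - 8 * s * t * d + 4 * d
    ^ 2 * e,
    -4 * s * d * x + 4 * s * e - 8 * t * d]


theorem bezoutDet_slopeCubic_eq_det {R : Type*} [CommRing R] {A B x y s d t e : R}
    (h : y ^ 2 = x ^ 3 + A * x + B) (u v : Fin 6 → R) (hu : u = bezoutEven A B x s d t e)
    (hv : v = bezoutOdd A B x s d t e) :
    bezoutDet (slopeCubic A x y (s + d) (t + e)) (slopeCubic A x y (s - d) (t - e)) =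
      Matrix.det !![u 0 + y * v 0, u 1 + y * v 1, u 2 + y * v 2;
        u 1 + y * v 1, u 3 + y * v 3, u 4 + y * v 4;
        u 2 + y * v 2, u 4 + y * v 4, u 5 + y * v 5] := by
  rw [slopeCubic_eq h, slopeCubic_eq h, bezoutDet]
  generalize hp : ![_, _, _, (s + d) * x + (t + e) - y] = p
  generalize hq : ![_, _, _, (s - d) * x + (t - e) - y] = q
  have e₀ : p 0 * q 1 - p 1 * q 0 = u 0 + y * v 0 := by
    rw [← hp, ← hq, hu, hv]
    simp only [bezoutEven, bezoutOdd, Matrix.cons_val]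
    linear_combination ((2 * (t + e) - (s + d) * x) * (-2 * (s - d) ^ 2 - 3 * x)
      - (-2 * (s + d) ^ 2 - 3 * x) * (2 * (t - e) - (s - d) * x)) * h
  have e₁ : p 0 * q 2 - p 2 * q 0 = u 1 + y * v 1 := by
    rw [← hp, ← hq, hu, hv]
    simp only [bezoutEven, bezoutOdd, Matrix.cons_val]
    linear_combination ((2 * (t + e) - (s + d) * x) * (-3 * (s - d))
      - (-3 * (s + d)) * (2 * (t - e) - (s - d) * x)) * h
  have e₂ : p 0 * q 3 - p 3 * q 0 = u 2 + y * v 2 := by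
    rw [← hp, ← hq, hu, hv]
    simp only [bezoutEven, bezoutOdd, Matrix.cons_val]
    linear_combination ((2 * (t + e) - (s + d) * x) * (-1)
      - (-1) * (2 * (t - e) - (s - d) * x)) * h
  have e₃ : (p 0 * q 3 - p 3 * q 0) + (p 1 * q 2 - p 2 * q 1) = u 3 + y * v 3 := by
    rw [← hp, ← hq, hu, hv]
    simp only [bezoutEven, bezoutOdd, Matrix.cons_val]
    linear_combination (((2 * (t + e) - (s + d) * x) * (-1)
      - (-1) * (2 * (t - e) - (s - d) * x)) +
      ((-2 * (s + d) ^ 2 - 3 * x) * (-3 * (s - d))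
      - (-3 * (s + d)) * (-2 * (s - d) ^ 2 - 3 * x))) * h
  have e₄ : p 1 * q 3 - p 3 * q 1 = u 4 + y * v 4 := by
    rw [← hp, ← hq, hu, hv]
    simp only [bezoutEven, bezoutOdd, Matrix.cons_val]
    linear_combination ((-2 * (s + d) ^ 2 - 3 * x) * (-1)
      - (-1) * (-2 * (s - d) ^ 2 - 3 * x)) * h
  have e₅ : p 2 * q 3 - p 3 * q 2 = u 5 + y * v 5 := by
    rw [← hp, ← hq, hu, hv]
    simp only [bezoutEven, bezoutOdd, Matrix.cons_val]
    linear_combination ((-3 * (s + d)) * (-1)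
      - (-1) * (-3 * (s - d))) * h
  rw [← e₀, ← e₁, ← e₂, ← e₃, ← e₄, ← e₅]

theorem bezout_even {F : Type*} [Field F] (A B x s d t e : F) (u v : Fin 6 → F)
    (hu : u = bezoutEven A B x s d t e) (hv : v = bezoutOdd A B x s d t e) :
    u 0 * (u 3 * u 5 - u 4 ^ 2 + (x ^ 3 + A * x + B) * (v 3 * v 5 - v 4 ^ 2))
        - u 1 * (u 1 * u 5 - u 2 * u 4 + (x ^ 3 + A * x + B) * (v 1 * v 5 - v 2 * v 4))
        + u 2 * (u 1 * u 4 - u 2 * u 3 + (x ^ 3 + A * x + B) * (v 1 * v 4 - v 2 * v 3))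
        + (x ^ 3 + A * x + B) * (v 0 * (u 3 * v 5 + v 3 * u 5 - 2 * u 4 * v 4)
          - v 1 * (u 1 * v 5 + v 1 * u 5 - u 2 * v 4 - v 2 * u 4)
          + v 2 * (u 1 * v 4 + v 1 * u 4 - u 2 * v 3 - v 2 * u 3)) =
      sCoeffB3 A B (s + d) (t + e) (d - s) (e - t) *
        (sCoeffA4 A B (s + d) (t + e) (s - d) (t - e) * x ^ 4
        + sCoeffA3 A B (s + d) (t + e) (s - d) (t - e) * x ^ 3
        + sCoeffA2 A B (s + d) (t + e) (s - d) (t - e) * x ^ 2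
        + sCoeffA1 A B (s + d) (t + e) (s - d) (t - e) * x
        + sCoeffA0 A B (s + d) (t + e) (s - d) (t - e)) := by
  subst hu hv
  simp only [bezoutEven, bezoutOdd, Matrix.cons_val, sCoeffA4, sCoeffA3, sCoeffA2, sCoeffA1,
    sCoeffA0, sCoeffB3]
  ring

theorem bezout_odd {F : Type*} [Field F] (A B x s d t e : F) (u v : Fin 6 → F)
    (hu : u = bezoutEven A B x s d t e) (hv : v = bezoutOdd A B x s d t e) :
    v 0 * (u 3 * u 5 - u 4 ^ 2 + (x ^ 3 + A * x + B) * (v 3 * v 5 - v 4 ^ 2))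
        - v 1 * (u 1 * u 5 - u 2 * u 4 + (x ^ 3 + A * x + B) * (v 1 * v 5 - v 2 * v 4))
        + v 2 * (u 1 * u 4 - u 2 * u 3 + (x ^ 3 + A * x + B) * (v 1 * v 4 - v 2 * v 3))
        + u 0 * (u 3 * v 5 + v 3 * u 5 - 2 * u 4 * v 4)
        - u 1 * (u 1 * v 5 + v 1 * u 5 - u 2 * v 4 - v 2 * u 4)
        + u 2 * (u 1 * v 4 + v 1 * u 4 - u 2 * v 3 - v 2 * u 3) =
      sCoeffB3 A B (s + d) (t + e) (d - s) (e - t) *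
        (sCoeffB3 A B (s + d) (t + e) (s - d) (t - e) * x ^ 3
        + sCoeffB2 A B (s + d) (t + e) (s - d) (t - e) * x ^ 2
        + sCoeffB1 A B (s + d) (t + e) (s - d) (t - e) * x
        + sCoeffB0 A B (s + d) (t + e) (s - d) (t - e)) := by
  subst hu hv
  simp only [bezoutEven, bezoutOdd, Matrix.cons_val, sCoeffB3, sCoeffB2, sCoeffB1, sCoeffB0]
  ring

/-- With slopes `s ± d` and constants `t ± e`, exchanging the lines is `(d, e) ↦ (-d, -e)`. Bézout's
entries are odd under it, which keeps their expansions short. Halving needs `2 ≠ 0`. -/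
theorem bezoutDet_slopeCubic {F : Type*} [Field F] (h2 : (2 : F) ≠ 0) {A B x y α₁ α₀ β₁ β₀ : F}
    (h : y ^ 2 = x ^ 3 + A * x + B) :
    bezoutDet (slopeCubic A x y α₁ α₀) (slopeCubic A x y β₁ β₀) =
      sCoeffB3 A B α₁ α₀ (-β₁) (-β₀) *
        (sCoeffA4 A B α₁ α₀ β₁ β₀ * x ^ 4 + sCoeffA3 A B α₁ α₀ β₁ β₀ * x ^ 3
          + sCoeffA2 A B α₁ α₀ β₁ β₀ * x ^ 2 + sCoeffA1 A B α₁ α₀ β₁ β₀ * x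
          + sCoeffA0 A B α₁ α₀ β₁ β₀
          + y * (sCoeffB3 A B α₁ α₀ β₁ β₀ * x ^ 3 + sCoeffB2 A B α₁ α₀ β₁ β₀ * x ^ 2
            + sCoeffB1 A B α₁ α₀ β₁ β₀ * x + sCoeffB0 A B α₁ α₀ β₁ β₀)) := by
  obtain ⟨s, d, rfl, rfl⟩ : ∃ s d, α₁ = s + d ∧ β₁ = s - d :=
    ⟨(α₁ + β₁) / 2, (α₁ - β₁) / 2, by field_simp; ring, by field_simp; ring⟩
  obtain ⟨t, e, rfl, rfl⟩ : ∃ t e, α₀ = t + e ∧ β₀ = t - e :=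
    ⟨(α₀ + β₀) / 2, (α₀ - β₀) / 2, by field_simp; ring, by field_simp; ring⟩
  rw [bezoutDet_slopeCubic_eq_det h _ _ rfl rfl, det_symm_add_smul h,
    bezout_even A B x s d t e _ _ rfl rfl, bezout_odd A B x s d t e _ _ rfl rfl, neg_sub, neg_sub]
  ring

/-- The line through `(x₁, y₁)` and `(x₂, y₂)`, as a determinant. -/
def lineDet {R : Type*} [CommRing R] (x y x₁ y₁ x₂ y₂ : R) : R :=
  (x₁ - x) * (y₂ - y) - (x₂ - x) * (y₁ - y)

/-- The elements are the `x`-coordinates of the intersection of `y² = x³ + A x + B` with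
`y = α₁ x + α₀`. -/
structure IsIntersection {R : Type*} [CommRing R] (A B α₁ α₀ : R) (x : Fin 3 → R) : Prop where
  sum_eq : x 0 + x 1 + x 2 = α₁ ^ 2
  sum_mul_eq : x 0 * x 1 + x 0 * x 2 + x 1 * x 2 = A - 2 * α₁ * α₀
  prod_eq : x 0 * x 1 * x 2 = α₀ ^ 2 - B

theorem IsIntersection.map {R S : Type*} [CommRing R] [CommRing S] (φ : R →+* S)
    {A B α₁ α₀ : R} {x : Fin 3 → R} (h : IsIntersection A B α₁ α₀ x) :
    IsIntersection (φ A) (φ B) (φ α₁) (φ α₀) (φ ∘ x) where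
  sum_eq := by simpa using congrArg φ h.sum_eq
  sum_mul_eq := by simpa [map_ofNat] using congrArg φ h.sum_mul_eq
  prod_eq := by simpa using congrArg φ h.prod_eq

/-- Each factor is `(z i - x) * s + (u - x) * g` with `s`, `g` as in the proof. Expanding needs only
the symmetric functions of the `z i - x`, and `∏ (z i - x) = g * (α₁ * x + α₀ - y)` on the curve, so
`g` splits off. -/
theorem IsIntersection.prod_lineDet {R : Type*} [CommRing R] {A B x y α₁ α₀ : R} {z : Fin 3 → R}
    (hz : IsIntersection A B α₁ α₀ z) (h : y ^ 2 = x ^ 3 + A * x + B) (u w : R) (p : Fin 4 → R)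
    (hp : p = slopeCubic A x y α₁ α₀) :
    ∏ i, lineDet x y (z i) (-(α₁ * z i + α₀)) u w =
      (y + α₁ * x + α₀) * (p 0 * (u - x) ^ 3 + p 1 * (u - x) ^ 2 * (w - y)
        + p 2 * (u - x) * (w - y) ^ 2 + p 3 * (w - y) ^ 3) := by
  subst hp
  simp only [Fin.prod_univ_three, lineDet, slopeCubic, Matrix.cons_val]
  set s := w - y + α₁ * (u - x) with hs
  set g := y + α₁ * x + α₀ with hg
  linear_combination s ^ 3 * (hz.prod_eq - x * hz.sum_mul_eq + x ^ 2 * hz.sum_eq)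
    + s ^ 2 * (u - x) * g * (hz.sum_mul_eq - 2 * x * hz.sum_eq)
    + s * (u - x) ^ 2 * g ^ 2 * hz.sum_eq + s ^ 3 * h

/-- The same cubic described by its roots: `n i / d i` is the slope of the line joining `(x, y)` to
the `i`-th intersection point. This puts the second line into the shape needed by
`prod_cubic_eq_bezoutDet`. -/
theorem IsIntersection.coeffs_eq {R : Type*} [CommRing R] {A B x y α₁ α₀ : R} {z : Fin 3 → R}
    (hz : IsIntersection A B α₁ α₀ z) (h : y ^ 2 = x ^ 3 + A * x + B) (n d : Fin 3 → R)
    (hn : ∀ i, n i = -(α₁ * z i + α₀) - y) (hd : ∀ i, d i = z i - x) :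
    ![n 0 * n 1 * n 2, -(n 0 * n 1 * d 2 + n 0 * d 1 * n 2 + d 0 * n 1 * n 2),
        n 0 * d 1 * d 2 + d 0 * n 1 * d 2 + d 0 * d 1 * n 2, -(d 0 * d 1 * d 2)] =
      fun i => -(y + α₁ * x + α₀) * slopeCubic A x y α₁ α₀ i := by
  obtain ⟨h₁, h₂, h₃⟩ := hz
  have e₁ : d 0 + d 1 + d 2 = α₁ ^ 2 - 3 * x := by simp only [hd]; linear_combination h₁
  have e₂ : d 0 * d 1 + d 0 * d 2 + d 1 * d 2 =
      3 * x ^ 2 + A - 2 * α₁ * (α₁ * x + α₀) := by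
    simp only [hd]; linear_combination h₂ - 2 * x * h₁
  have e₃ : d 0 * d 1 * d 2 = (y + α₁ * x + α₀) * (α₁ * x + α₀ - y) := by
    simp only [hd]; linear_combination h₃ - x * h₂ + x ^ 2 * h₁ + h
  have hn' : ∀ i, n i = -(α₁ * d i + (y + α₁ * x + α₀)) := fun i => by rw [hn, hd]; ring
  funext i
  fin_cases i <;>
    simp only [slopeCubic, hn', Matrix.cons_val, Fin.mk_zero, Fin.mk_one, Fin.reduceFinMk] <;>
    set g := y + α₁ * x + α₀
  · linear_combination -(g ^ 2 * α₁) * e₁ - g * α₁ ^ 2 * e₂ - α₁ ^ 3 * e₃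
  · linear_combination -(g ^ 2) * e₁ - 2 * g * α₁ * e₂ - 3 * α₁ ^ 2 * e₃
  · linear_combination -g * e₂ - 3 * α₁ * e₃
  · linear_combination -e₃

/-- For fixed `j` the product over `i` is the first slope cubic evaluated at the `j`-th root of the
second one, so the product over `j` is a resultant. Each of the two lines contributes its cube. -/
theorem prod_prod_lineDet {F : Type*} [Field F] (h2 : (2 : F) ≠ 0)
    {A B x y α₁ α₀ β₁ β₀ : F} {z u : Fin 3 → F}
    (hz : IsIntersection A B α₁ α₀ z) (hu : IsIntersection A B β₁ β₀ u)
    (h : y ^ 2 = x ^ 3 + A * x + B) :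
    ∏ j, ∏ i, lineDet x y (z i) (-(α₁ * z i + α₀)) (u j) (-(β₁ * u j + β₀)) =
      -((y + α₁ * x + α₀) * (y + β₁ * x + β₀)) ^ 3 * (sCoeffB3 A B α₁ α₀ (-β₁) (-β₀) *
        (sCoeffA4 A B α₁ α₀ β₁ β₀ * x ^ 4 + sCoeffA3 A B α₁ α₀ β₁ β₀ * x ^ 3
          + sCoeffA2 A B α₁ α₀ β₁ β₀ * x ^ 2 + sCoeffA1 A B α₁ α₀ β₁ β₀ * x
          + sCoeffA0 A B α₁ α₀ β₁ β₀
          + y * (sCoeffB3 A B α₁ α₀ β₁ β₀ * x ^ 3 + sCoeffB2 A B α₁ α₀ β₁ β₀ * x ^ 2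
            + sCoeffB1 A B α₁ α₀ β₁ β₀ * x + sCoeffB0 A B α₁ α₀ β₁ β₀))) := by
  simp only [hz.prod_lineDet h _ _ _ rfl, Finset.prod_mul_distrib, Finset.prod_const,
    Finset.card_univ, Fintype.card_fin]
  rw [Fin.prod_univ_three, prod_cubic_eq_bezoutDet,
    hu.coeffs_eq h (fun j => -(β₁ * u j + β₀) - y) (fun j => u j - x) (fun _ => rfl) fun _ => rfl,
    bezoutDet_smul, bezoutDet_slopeCubic h2 h]
  ring

/-! ### Frobenius and the trace-zero subgroup -/

section

/-- The polynomial `X ^ q - X` has at most `q` roots, and the elements of `F` already provide `q` of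
them. -/
theorem exists_algebraMap_eq_of_pow_card_eq {F L : Type*} [Field F] [Fintype F] [Field L]
    [Algebra F L] {x : L} (hx : x ^ Fintype.card F = x) : ∃ a : F, algebraMap F L a = x := by
  classical
  have hq := FiniteField.X_pow_card_sub_X_ne_zero L (Fintype.one_lt_card (α := F))
  by_contra! h
  have hsub : insert x (Finset.univ.image (algebraMap F L)) ⊆
      (X ^ Fintype.card F - X : L[X]).roots.toFinset := by
    intro z hz
    rw [Multiset.mem_toFinset, mem_roots hq, IsRoot.def, eval_sub, eval_pow, eval_X, sub_eq_zero]
    rcases Finset.mem_insert.1 hz with rfl | hz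
    · exact hx
    · obtain ⟨a, -, rfl⟩ := Finset.mem_image.1 hz
      rw [← map_pow, FiniteField.pow_card]
  have h₁ := (Finset.card_le_card hsub).trans ((Multiset.toFinset_card_le _).trans (card_roots' _))
  rw [FiniteField.X_pow_card_sub_X_natDegree_eq L Fintype.one_lt_card,
    Finset.card_insert_of_notMem (by simpa using h),
    Finset.card_image_of_injective _ (algebraMap F L).injective, Finset.card_univ] at h₁
  omega

section Curve

variable {F K : Type*} [Field F] [Field K] [Algebra F K] {A B : F}

theorem curve_equation_iff {x y : K} :
    ((curve A B)⁄K).Equation x y ↔ y ^ 2 = x ^ 3 + algebraMap F K A * x + algebraMap F K B := by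
  simp [WeierstrassCurve.Affine.equation_iff, curve]

theorem curve_negY (x y : K) : ((curve A B)⁄K).negY x y = -y := by
  simp [WeierstrassCurve.Affine.negY, curve]

theorem neg_some_eq {x y : K} (h : ((curve A B)⁄K).Nonsingular x y) :
    ∃ h', -(WeierstrassCurve.Affine.Point.some x y h) = .some x (-y) h' := by
  have := (WeierstrassCurve.Affine.nonsingular_neg x y).2 h
  rw [curve_negY] at this
  refine ⟨this, ?_⟩
  rw [WeierstrassCurve.Affine.Point.neg_some]
  simp [curve]

end Curve

variable {F L : Type*} [Field F] [Fintype F] [Field L] [Algebra F L] [DecidableEq L] {A B : F}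

theorem frob_some {x y : L} (h : ((curve A B)⁄L).Nonsingular x y) :
    ∃ h', frob A B (.some x y h) = .some (x ^ Fintype.card F) (y ^ Fintype.card F) h' :=
  ⟨_, rfl⟩

theorem mem_traceZero {Q : ((curve A B)⁄L).Point} :
    Q ∈ traceZero L A B ↔ Q + frob A B Q + frob A B (frob A B Q) = 0 := by
  simp [traceZero]

theorem frob_mem_traceZero {Q : ((curve A B)⁄L).Point} (hQ : Q ∈ traceZero L A B) :
    frob A B Q ∈ traceZero L A B := by
  rw [mem_traceZero] at hQ ⊢
  rw [← map_add, ← map_add, hQ, map_zero]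

theorem iterate_frob_mem_traceZero {Q : ((curve A B)⁄L).Point} (hQ : Q ∈ traceZero L A B) (n : ℕ) :
    (frob A B)^[n] Q ∈ traceZero L A B := by
  induction n with
  | zero => exact hQ
  | succ n ih =>
    rw [Function.iterate_succ_apply']
    exact frob_mem_traceZero ih

theorem frob_frob_eq {Q : ((curve A B)⁄L).Point} (hQ : Q ∈ traceZero L A B) :
    frob A B (frob A B Q) = -(Q + frob A B Q) :=
  (neg_eq_of_add_eq_zero_right (mem_traceZero.1 hQ)).symm

theorem frob_frob_frob {Q : ((curve A B)⁄L).Point} (hQ : Q ∈ traceZero L A B) :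
    frob A B (frob A B (frob A B Q)) = Q := by
  rw [frob_frob_eq (frob_mem_traceZero hQ), frob_frob_eq hQ]
  abel

theorem frob_injective : Function.Injective (frob A B : ((curve A B)⁄L).Point →+ _) :=
  WeierstrassCurve.Affine.Point.map_injective _

/-- The group has no nontrivial elements of order two and three. -/
structure NoTwoThreeTorsion {G : Type*} [AddCommGroup G] (T : AddSubgroup G) : Prop where
  two : ∀ Q ∈ T, Q + Q = 0 → Q = 0
  three : ∀ Q ∈ T, Q + Q + Q = 0 → Q = 0

theorem noTwoThreeTorsion_of_card {G : Type*} [AddCommGroup G] {T : AddSubgroup G} {p : ℕ}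
    (hp : p.Prime) (hp3 : 3 < p) (hT : Nat.card T = p) : NoTwoThreeTorsion T := by
  have key : ∀ n : ℕ, n.Coprime p → ∀ Q ∈ T, n • Q = 0 → Q = 0 := by
    intro n hn Q hQ h
    have h' : p • (⟨Q, hQ⟩ : T) = 0 := by rw [← hT]; exact card_nsmul_eq_zero'
    have h'' : p • Q = 0 := congrArg Subtype.val h'
    rw [← AddMonoid.addOrderOf_eq_one_iff, ← Nat.dvd_one, ← hn]
    exact Nat.dvd_gcd (addOrderOf_dvd_of_nsmul_eq_zero h) (addOrderOf_dvd_of_nsmul_eq_zero h'')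
  have hc : ∀ n, 0 < n → n < p → n.Coprime p := fun n h0 h =>
    ((Nat.Prime.coprime_iff_not_dvd hp).2 fun hd => (Nat.le_of_dvd h0 hd).not_gt h).symm
  refine ⟨fun Q hQ h => key 2 (hc 2 (by norm_num) (by omega)) Q hQ ?_,
    fun Q hQ h => key 3 (hc 3 (by norm_num) hp3) Q hQ ?_⟩
  · rw [two_nsmul, h]
  · rw [← h]; abel

section Orbit

variable (hT : NoTwoThreeTorsion (traceZero L A B)) {Q : ((curve A B)⁄L).Point}
include hT

/-- If `φ(Q) = Q`, the trace is `3Q`; if `φ(Q) = -Q`, it is `Q - Q + Q = Q`. -/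
theorem frob_ne (hQ : Q ∈ traceZero L A B) (h0 : Q ≠ 0) :
    frob A B Q ≠ Q ∧ frob A B Q ≠ -Q := by
  have h := mem_traceZero.1 hQ
  constructor <;> intro e
  · rw [e, e] at h
    exact h0 (hT.three Q hQ h)
  · rw [e, map_neg, e] at h
    exact h0 (by simpa using h)

theorem frob_frob_ne (hQ : Q ∈ traceZero L A B) (h0 : Q ≠ 0) :
    frob A B (frob A B Q) ≠ Q ∧ frob A B (frob A B Q) ≠ -Q := by
  constructor <;> intro e
  · have := frob_frob_frob hQ
    rw [e] at this
    exact (frob_ne hT hQ h0).1 this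
  · have := frob_frob_frob hQ
    rw [e, map_neg] at this
    exact (frob_ne hT hQ h0).2 (by rw [← this, neg_neg, this])

theorem ne_neg_self (hQ : Q ∈ traceZero L A B) (h0 : Q ≠ 0) : Q ≠ -Q := fun e =>
  h0 (hT.two Q hQ (by nth_rw 2 [e]; simp))

end Orbit

end

/-! ### The line through a Frobenius orbit -/

section

variable {F L : Type*} [Field F] [Fintype F] [Field L] [Algebra F L] [DecidableEq L] {A B : F}

/-- The points `φⁱ(Q)` are the three intersection points of the curve with the line `h`, and `z`
lists their `x`-coordinates. -/
structure LineOrbit (h : Line F) (Q : ((curve A B)⁄L).Point) (z : Fin 3 → L) : Prop where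
  eq_some : ∀ i : Fin 3, ∃ hz, (frob A B)^[i] Q =
    .some (z i) (algebraMap F L h.slope * z i + algebraMap F L h.const) hz
  injective : Function.Injective z

omit [Fintype F] [DecidableEq L] in
theorem Line.Contains.exists_eq {h : Line F} {Q : ((curve A B)⁄L).Point} (hQ : h.Contains Q) :
    ∃ x hx, Q = .some x (algebraMap F L h.slope * x + algebraMap F L h.const) hx := by
  rcases Q with _ | ⟨x, y, hxy⟩
  · exact hQ.elim
  · obtain rfl : y = _ := hQ
    exact ⟨x, hxy, rfl⟩

theorem IsLineOf.ne_zero {h : Line F} {Q : ((curve A B)⁄L).Point} (hQ : IsLineOf h Q) : Q ≠ 0 := by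
  rintro rfl
  exact hQ.1

theorem IsLineOf.iterate {h : Line F} {Q : ((curve A B)⁄L).Point} (hQ : IsLineOf h Q)
    (i : Fin 3) : h.Contains ((frob A B)^[i] Q) := by
  fin_cases i
  exacts [hQ.1, hQ.2.1, hQ.2.2]

theorem Line.contains_frob {h : Line F} {Q : ((curve A B)⁄L).Point} (hQ : h.Contains Q) :
    h.Contains (frob A B Q) := by
  obtain ⟨x, hx, rfl⟩ := hQ.exists_eq
  obtain ⟨h', e⟩ := frob_some hx
  rw [e]
  change FiniteField.frobeniusAlgHom F L (_ * x + _) =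
    _ * FiniteField.frobeniusAlgHom F L x + _
  rw [map_add, map_mul, AlgHom.commutes, AlgHom.commutes]

/-- Points with equal `x`-coordinates agree up to sign, and no two of `Q`, `φ(Q)`, `φ²(Q)` do. -/
theorem IsLineOf.lineOrbit (hT : NoTwoThreeTorsion (traceZero L A B)) {h : Line F}
    {Q : ((curve A B)⁄L).Point} (hh : IsLineOf h Q) (hQ : Q ∈ traceZero L A B) :
    ∃ z, LineOrbit h Q z := by
  choose z hz hz' using fun i => (hh.iterate i).exists_eq
  refine ⟨z, fun i => ⟨hz i, hz' i⟩, ?_⟩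
  have h0 := hh.ne_zero
  have hx : ∀ i j, z i = z j → (frob A B)^[i] Q = (frob A B)^[j] Q ∨
      (frob A B)^[i] Q = -(frob A B)^[j] Q := fun i j e => by
    rw [hz' i, hz' j]
    exact WeierstrassCurve.Affine.Point.X_eq_iff.1 e
  have h1 := frob_mem_traceZero hQ
  have h1' : frob A B Q ≠ 0 := fun e => h0 (frob_injective (e.trans (map_zero _).symm))
  have k₁ : z 1 ≠ z 0 := fun e => not_or.2 (frob_ne hT hQ h0) (hx 1 0 e)
  have k₂ : z 2 ≠ z 0 := fun e => not_or.2 (frob_frob_ne hT hQ h0) (hx 2 0 e)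
  have k₃ : z 2 ≠ z 1 := fun e => not_or.2 (frob_ne hT h1 h1') (hx 2 1 e)
  intro i j
  fin_cases i <;> fin_cases j <;> intro e <;>
    first | rfl | exact absurd e ‹_› | exact absurd e.symm ‹_›

theorem LineOrbit.isIntersection {h : Line F} {Q : ((curve A B)⁄L).Point} {z : Fin 3 → L}
    (hz : LineOrbit h Q z) : IsIntersection (algebraMap F L A) (algebraMap F L B)
      (algebraMap F L h.slope) (algebraMap F L h.const) z := by
  have e : ∀ i, (algebraMap F L h.slope * z i + algebraMap F L h.const) ^ 2 =
      z i ^ 3 + algebraMap F L A * z i + algebraMap F L B := fun i => by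
    obtain ⟨hn, -⟩ := hz.eq_some i
    exact curve_equation_iff.1 hn.1
  have n₁ : z 0 - z 1 ≠ 0 := sub_ne_zero.2 fun e => by simpa using hz.injective e
  have n₂ : z 0 - z 2 ≠ 0 := sub_ne_zero.2 fun e => by simpa using hz.injective e
  have n₃ : z 1 - z 2 ≠ 0 := sub_ne_zero.2 fun e => by simpa using hz.injective e
  set a := algebraMap F L h.slope
  set b := algebraMap F L h.const
  -- Vieta's formulas via divided differences: the cubic vanishes at the three distinct `z i`, so
  -- differences of its values can be divided by `z i - z j`.
  have e₁ : z 0 ^ 2 + z 0 * z 1 + z 1 ^ 2 + algebraMap F L A - a ^ 2 * (z 0 + z 1) -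
      2 * a * b = 0 :=
    mul_left_cancel₀ n₁ (by linear_combination e 1 - e 0)
  have e₂ : z 0 ^ 2 + z 0 * z 2 + z 2 ^ 2 + algebraMap F L A - a ^ 2 * (z 0 + z 2) -
      2 * a * b = 0 :=
    mul_left_cancel₀ n₂ (by linear_combination e 2 - e 0)
  have s₁ : z 0 + z 1 + z 2 = a ^ 2 := mul_left_cancel₀ n₃ (by linear_combination e₁ - e₂)
  have s₂ : z 0 * z 1 + z 0 * z 2 + z 1 * z 2 = algebraMap F L A - 2 * a * b := by
    linear_combination (z 0 + z 1) * s₁ - e₁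
  exact ⟨s₁, s₂, by linear_combination z 0 * s₂ - z 0 ^ 2 * s₁ - e 0⟩

/-- Two points of trace zero on the same line are conjugate. -/
theorem LineOrbit.eq_iterate {h : Line F} {Q R : ((curve A B)⁄L).Point} {z : Fin 3 → L}
    (hz : LineOrbit h Q z) (hR : h.Contains R) : ∃ i : Fin 3, R = (frob A B)^[i] Q := by
  obtain ⟨x, hx, rfl⟩ := hR.exists_eq
  obtain ⟨s₁, s₂, s₃⟩ := hz.isIntersection
  have e := curve_equation_iff.1 hx.1
  have : (x - z 0) * ((x - z 1) * (x - z 2)) = 0 := by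
    linear_combination -e - x ^ 2 * s₁ + x * s₂ - s₃
  have key : ∀ i, x = z i → ∃ i : Fin 3, WeierstrassCurve.Affine.Point.some _ _ hx =
      (frob A B)^[i] Q := by
    rintro i rfl
    obtain ⟨hn, e⟩ := hz.eq_some i
    exact ⟨i, e.symm⟩
  rcases mul_eq_zero.1 this with h | h
  · exact key 0 (sub_eq_zero.1 h)
  rcases mul_eq_zero.1 h with h | h
  · exact key 1 (sub_eq_zero.1 h)
  · exact key 2 (sub_eq_zero.1 h)

theorem IsLineOf.frob {h : Line F} {Q : ((curve A B)⁄L).Point} (hh : IsLineOf h Q) :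
    IsLineOf h (TraceZero.frob A B Q) :=
  ⟨hh.2.1, hh.2.2, Line.contains_frob hh.2.2⟩

theorem isLineOf_frob_iff {h : Line F} {Q : ((curve A B)⁄L).Point} (hQ : Q ∈ traceZero L A B) :
    IsLineOf h (frob A B Q) ↔ IsLineOf h Q :=
  ⟨fun hh => by have := hh.frob.frob; rwa [frob_frob_frob hQ] at this, fun hh => hh.frob⟩

theorem isLineOf_iterate_frob_iff {h : Line F} {Q : ((curve A B)⁄L).Point}
    (hQ : Q ∈ traceZero L A B) (n : ℕ) : IsLineOf h ((frob A B)^[n] Q) ↔ IsLineOf h Q := by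
  induction n with
  | zero => rfl
  | succ n ih =>
    rw [Function.iterate_succ_apply', isLineOf_frob_iff (iterate_frob_mem_traceZero hQ n), ih]

omit [Fintype F] [DecidableEq L] in
theorem Line.Contains.neg {h : Line F} {Q : ((curve A B)⁄L).Point} (hh : h.Contains Q) :
    h.neg.Contains (-Q) := by
  obtain ⟨x, hx, rfl⟩ := hh.exists_eq
  obtain ⟨h', e⟩ := neg_some_eq hx
  rw [e]
  simp only [Line.Contains, Line.neg, map_neg]
  ring

theorem IsLineOf.neg {h : Line F} {Q : ((curve A B)⁄L).Point} (hh : IsLineOf h Q) :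
    IsLineOf h.neg (-Q) := by
  refine ⟨hh.1.neg, ?_, ?_⟩
  · rw [map_neg]; exact hh.2.1.neg
  · rw [map_neg, map_neg]; exact hh.2.2.neg

omit [Fintype F] in
theorem Line.neg_neg (h : Line F) : h.neg.neg = h := by
  ext <;> simp [Line.neg]

/-- An `x`-coordinate in `F` would be fixed by Frobenius, contradicting `z 1 ≠ z 0`. -/
theorem LineOrbit.not_mem_range {h : Line F} {Q : ((curve A B)⁄L).Point} {z : Fin 3 → L}
    (hz : LineOrbit h Q z) (a : F) : z 0 ≠ algebraMap F L a := fun e => by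
  obtain ⟨h₀, e₀⟩ := hz.eq_some 0
  obtain ⟨h₁, e₁⟩ := hz.eq_some 1
  obtain ⟨h₂, e₂⟩ := frob_some h₀
  have : z 1 = z 0 ^ Fintype.card F := by
    have h : frob A B Q = _ := e₁
    rw [show Q = _ from e₀, e₂] at h
    exact (WeierstrassCurve.Affine.Point.some.inj h).1.symm
  rw [e, ← map_pow, FiniteField.pow_card, ← e] at this
  simpa using hz.injective this

/-- The line of a point is unique. -/
theorem LineOrbit.eq_of_contains {h : Line F} {Q : ((curve A B)⁄L).Point} {z : Fin 3 → L}
    (hz : LineOrbit h Q z) (h' : Line F) (hQ : h'.Contains Q) : h' = h := by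
  obtain ⟨h₀, e₀⟩ := hz.eq_some 0
  rw [show Q = _ from e₀] at hQ
  have hQ : algebraMap F L h.slope * z 0 + algebraMap F L h.const =
    algebraMap F L h'.slope * z 0 + algebraMap F L h'.const := hQ
  by_cases hs : h'.slope = h.slope
  · rw [hs] at hQ
    exact Line.ext hs ((algebraMap F L).injective (add_left_cancel hQ)).symm
  -- Two lines over `F` with different slopes meet in a point whose `x`-coordinate is in `F`.
  · refine absurd ?_ (hz.not_mem_range ((h.const - h'.const) / (h'.slope - h.slope)))
    have : algebraMap F L h'.slope - algebraMap F L h.slope ≠ 0 := by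
      rw [← map_sub]
      exact (_root_.map_ne_zero _).2 (sub_ne_zero.2 hs)
    rw [map_div₀, map_sub, map_sub, eq_div_iff this]
    linear_combination -hQ

/-- Frobenius sends the line through `Q` and `φ(Q)` to the one through `φ(Q)` and `φ²(Q)`. Since
`φ²(Q) = -(Q + φ(Q))`, these coincide, so slope and constant are fixed by Frobenius and belong to
`F`. -/
theorem exists_isLineOf (hT : NoTwoThreeTorsion (traceZero L A B)) {Q : ((curve A B)⁄L).Point}
    (hQ : Q ∈ traceZero L A B) (h0 : Q ≠ 0) : ∃ h : Line F, IsLineOf h Q := by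
  have hne := frob_ne hT hQ h0
  have h0' : frob A B Q ≠ 0 := fun e => h0 (frob_injective (e.trans (map_zero _).symm))
  have hne' := frob_ne hT (frob_mem_traceZero hQ) h0'
  have hff := frob_frob_eq hQ
  rcases Q with _ | ⟨x, y, hxy⟩
  · exact absurd rfl h0
  obtain ⟨hxy', e⟩ := frob_some hxy
  rw [e] at hne hne' hff
  obtain ⟨hxy'', e'⟩ := frob_some hxy'
  rw [e'] at hff hne'
  have hx : x ≠ x ^ Fintype.card F := fun e => by
    rcases WeierstrassCurve.Affine.Point.X_eq_iff.1 e.symm with h | h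
    exacts [hne.1 h, hne.2 h]
  have hx' : x ^ Fintype.card F ≠ (x ^ Fintype.card F) ^ Fintype.card F := fun e => by
    rcases WeierstrassCurve.Affine.Point.X_eq_iff.1 e.symm with h | h
    exacts [hne'.1 h, hne'.2 h]
  rw [← neg_eq_iff_eq_neg, WeierstrassCurve.Affine.Point.add_of_X_ne' hx, neg_inj] at hff
  obtain ⟨hX, hY⟩ := WeierstrassCurve.Affine.Point.some.inj hff
  rw [WeierstrassCurve.Affine.negAddY, ← hX] at hY
  rw [WeierstrassCurve.Affine.slope_of_X_ne hx] at hY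
  obtain ⟨l, hl⟩ : ∃ l, l = (y - y ^ Fintype.card F) / (x - x ^ Fintype.card F) := ⟨_, rfl⟩
  rw [← hl] at hY
  rw [eq_div_iff (sub_ne_zero.2 hx)] at hl
  set φ := FiniteField.frobeniusAlgHom F L
  have hφ : ∀ z, z ^ Fintype.card F = φ z := fun _ => rfl
  simp only [hφ] at hl hY hx hx'
  have hl' : φ l = l := by
    have := congrArg φ hl
    rw [map_mul, map_sub, map_sub] at this
    refine mul_right_cancel₀ (sub_ne_zero.2 hx') (this.trans ?_)
    linear_combination hl - hY
  obtain ⟨a, rfl⟩ := exists_algebraMap_eq_of_pow_card_eq hl'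
  obtain ⟨b, hb⟩ := exists_algebraMap_eq_of_pow_card_eq (F := F) (x := y - algebraMap F L a * x) (by
    change φ _ = _
    rw [map_sub, map_mul, hl']
    linear_combination hl)
  have hc : (⟨a, b⟩ : Line F).Contains (A := A) (B := B) (.some x y hxy) := by
    change y = algebraMap F L a * x + algebraMap F L b
    rw [hb]
    ring
  exact ⟨⟨a, b⟩, hc, Line.contains_frob hc, Line.contains_frob (Line.contains_frob hc)⟩

end

/-! ### Divisors as ideals of the coordinate ring, and the formulas for `S` -/

open WeierstrassCurve.Affine (CoordinateRing)
open WeierstrassCurve.Affine.CoordinateRing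

section CoordinateRing

variable {F L : Type*} [Field F] [Field L] [Algebra F L] {A B : F}

/-- The constants in the coordinate ring. -/
def coordC (A B : F) (L : Type*) [Field L] [Algebra F L] :
    L →+* CoordinateRing ((curve A B)⁄L) :=
  (mk ((curve A B)⁄L)).comp (C.comp C)

/-- The function `x` on the curve. -/
def coordX (A B : F) (L : Type*) [Field L] [Algebra F L] : CoordinateRing ((curve A B)⁄L) :=
  mk ((curve A B)⁄L) (C X)

/-- The function `y` on the curve. -/
def coordY (A B : F) (L : Type*) [Field L] [Algebra F L] : CoordinateRing ((curve A B)⁄L) :=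
  mk ((curve A B)⁄L) Y

theorem coordY_sq : coordY A B L ^ 2 = coordX A B L ^ 3 +
    coordC A B L (algebraMap F L A) * coordX A B L + coordC A B L (algebraMap F L B) := by
  simp only [coordY, coordX, coordC, RingHom.comp_apply, ← map_pow, ← map_mul, ← map_add]
  refine AdjoinRoot.mk_eq_mk.2 ⟨1, ?_⟩
  simp [WeierstrassCurve.Affine.polynomial, curve]

theorem XClass_eq (x : L) :
    XClass ((curve A B)⁄L) x = coordX A B L - coordC A B L x := by
  simp [XClass, coordX, coordC]

theorem YClass_linePolynomial (x y l : L) :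
    YClass ((curve A B)⁄L) (WeierstrassCurve.Affine.linePolynomial x y l) =
      coordY A B L - (coordC A B L l * (coordX A B L - coordC A B L x) + coordC A B L y) := by
  simp [YClass, coordX, coordC, coordY, WeierstrassCurve.Affine.linePolynomial]

theorem isUnit_coordC {a : L} (ha : a ≠ 0) : IsUnit (coordC A B L a) :=
  (isUnit_iff_ne_zero.2 ha).map _

theorem pointIdeal_zero : pointIdeal (0 : ((curve A B)⁄L).Point) = 1 :=
  Ideal.one_eq_top.symm

theorem pointIdeal_neg_mul {x y : L} (h : ((curve A B)⁄L).Nonsingular x y) :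
    pointIdeal (-(WeierstrassCurve.Affine.Point.some x y h)) * pointIdeal (.some x y h) =
      Ideal.span {coordX A B L - coordC A B L x} := by
  rw [← XClass_eq]
  exact XYIdeal_neg_mul h

/-- The divisor of a line through two points. -/
theorem span_lineDet [DecidableEq L] {x₁ y₁ x₂ y₂ : L} (h₁ : ((curve A B)⁄L).Nonsingular x₁ y₁)
    (h₂ : ((curve A B)⁄L).Nonsingular x₂ y₂)
    (hne : WeierstrassCurve.Affine.Point.some x₁ y₁ h₁ ≠ .some x₂ y₂ h₂) :
    Ideal.span {lineDet (coordX A B L) (coordY A B L) (coordC A B L x₁) (coordC A B L y₁)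
        (coordC A B L x₂) (coordC A B L y₂)} =
      pointIdeal (.some x₁ y₁ h₁) * pointIdeal (.some x₂ y₂ h₂) *
        pointIdeal (-(.some x₁ y₁ h₁ + .some x₂ y₂ h₂)) := by
  by_cases hx : x₁ = x₂
  -- Vertical line: the points are opposite and the third intersection is `P_∞`, with unit ideal.
  · rcases WeierstrassCurve.Affine.Point.X_eq_iff.1 hx with h | h
    · exact absurd h hne
    rw [h, neg_add_cancel, _root_.neg_zero, pointIdeal_zero, mul_one, pointIdeal_neg_mul]
    subst hx
    have hy : y₂ - y₁ ≠ 0 := fun e => hne (by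
      obtain rfl : y₂ = y₁ := sub_eq_zero.1 e
      rfl)
    have hd : lineDet (coordX A B L) (coordY A B L) (coordC A B L x₁) (coordC A B L y₁)
        (coordC A B L x₁) (coordC A B L y₂) =
        coordC A B L (-(y₂ - y₁)) * (coordX A B L - coordC A B L x₁) := by
      simp only [lineDet, map_neg, map_sub]
      ring
    rw [hd, Ideal.span_singleton_mul_left_unit (isUnit_coordC (neg_ne_zero.2 hy))]
  · have key := XYIdeal_mul_XYIdeal h₁.1 h₂.1 (fun e => hx e.1)
    rw [WeierstrassCurve.Affine.Point.add_of_X_ne hx]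
    have h₃ := WeierstrassCurve.Affine.nonsingular_add h₁ h₂ (fun e => hx e.1)
    set l := ((curve A B)⁄L).slope x₁ x₂ y₁ y₂ with hl
    set x₃ := ((curve A B)⁄L).addX x₁ x₂ l
    set y₃ := ((curve A B)⁄L).addY x₁ x₂ y₁ l
    have hn := pointIdeal_neg_mul h₃
    rw [WeierstrassCurve.Affine.slope_of_X_ne hx, eq_div_iff (sub_ne_zero.2 hx)] at hl
    have hd : lineDet (coordX A B L) (coordY A B L) (coordC A B L x₁) (coordC A B L y₁)
        (coordC A B L x₂) (coordC A B L y₂) = coordC A B L (x₂ - x₁) *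
        YClass ((curve A B)⁄L) (WeierstrassCurve.Affine.linePolynomial x₁ y₁ l) := by
      have := congrArg (coordC A B L) hl
      rw [YClass_linePolynomial, lineDet]
      simp only [map_mul, map_sub] at this ⊢
      linear_combination -(coordX A B L - coordC A B L x₁) * this
    rw [hd, Ideal.span_singleton_mul_left_unit (isUnit_coordC (sub_ne_zero.2 (Ne.symm hx)))]
    -- The addition law `key` involves the ideal of the sum; multiplying by the ideal of its
    -- negative turns it into the principal ideal of `x - x₃`, which cancels.
    refine (Ideal.span_singleton_mul_right_inj (XClass_ne_zero x₃)).1 ?_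
    change XIdeal _ _ * YIdeal _ _ = XIdeal _ _ * _
    change _ * (pointIdeal (.some x₁ y₁ h₁) * pointIdeal (.some x₂ y₂ h₂)) =
      _ * pointIdeal (.some x₃ y₃ h₃) at key
    rw [← mul_assoc, key, mul_assoc, mul_comm (pointIdeal (.some x₃ y₃ h₃)), hn, ← XClass_eq,
      mul_comm]
    rfl

variable (h k : Line F)

/-- The function `y - (α₁ x + α₀)` of a line. -/
def Line.toFunction (A B : F) (L : Type*) [Field L] [Algebra F L] (h : Line F) :
    CoordinateRing ((curve A B)⁄L) :=
  coordY A B L - (coordC A B L (algebraMap F L h.slope) * coordX A B L +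
    coordC A B L (algebraMap F L h.const))

theorem Line.toFunction_ne_zero : h.toFunction A B L ≠ 0 := by
  have := YClass_ne_zero (W' := (curve A B)⁄L)
    (C (algebraMap F L h.slope) * X + C (algebraMap F L h.const))
  simpa [YClass, Line.toFunction, coordX, coordY, coordC] using this

theorem Line.toFunction_neg : h.neg.toFunction A B L =
    coordY A B L + coordC A B L (algebraMap F L h.slope) * coordX A B L +
      coordC A B L (algebraMap F L h.const) := by
  simp only [Line.toFunction, Line.neg, map_neg]
  ring

theorem map_sCoeff {F K : Type*} [Field F] [Field K] (φ : F →+* K) (A B α₁ α₀ β₁ β₀ : F) :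
    φ (sCoeffA4 A B α₁ α₀ β₁ β₀) = sCoeffA4 (φ A) (φ B) (φ α₁) (φ α₀) (φ β₁) (φ β₀) ∧
    φ (sCoeffA3 A B α₁ α₀ β₁ β₀) = sCoeffA3 (φ A) (φ B) (φ α₁) (φ α₀) (φ β₁) (φ β₀) ∧
    φ (sCoeffA2 A B α₁ α₀ β₁ β₀) = sCoeffA2 (φ A) (φ B) (φ α₁) (φ α₀) (φ β₁) (φ β₀) ∧
    φ (sCoeffA1 A B α₁ α₀ β₁ β₀) = sCoeffA1 (φ A) (φ B) (φ α₁) (φ α₀) (φ β₁) (φ β₀) ∧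
    φ (sCoeffA0 A B α₁ α₀ β₁ β₀) = sCoeffA0 (φ A) (φ B) (φ α₁) (φ α₀) (φ β₁) (φ β₀) ∧
    φ (sCoeffB3 A B α₁ α₀ β₁ β₀) = sCoeffB3 (φ A) (φ B) (φ α₁) (φ α₀) (φ β₁) (φ β₀) ∧
    φ (sCoeffB2 A B α₁ α₀ β₁ β₀) = sCoeffB2 (φ A) (φ B) (φ α₁) (φ α₀) (φ β₁) (φ β₀) ∧
    φ (sCoeffB1 A B α₁ α₀ β₁ β₀) = sCoeffB1 (φ A) (φ B) (φ α₁) (φ α₀) (φ β₁) (φ β₀) ∧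
    φ (sCoeffB0 A B α₁ α₀ β₁ β₀) = sCoeffB0 (φ A) (φ B) (φ α₁) (φ α₀) (φ β₁) (φ β₀) := by
  refine ⟨?_, ?_, ?_, ?_, ?_, ?_, ?_, ?_, ?_⟩
  · simp only [sCoeffA4, map_add, map_sub, map_mul, map_neg, map_pow, map_ofNat]
  · simp only [sCoeffA3, map_add, map_sub, map_mul, map_pow, map_ofNat]
  · simp only [sCoeffA2, map_add, map_sub, map_mul, map_neg, map_pow, map_ofNat]
  · simp only [sCoeffA1, map_add, map_sub, map_mul, map_neg, map_pow, map_ofNat]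
  · simp only [sCoeffA0, map_add, map_sub, map_mul, map_neg, map_pow, map_ofNat]
  · simp only [sCoeffB3, map_add, map_sub, map_mul, map_pow, map_ofNat]
  · simp only [sCoeffB2, map_add, map_sub, map_mul, map_pow, map_ofNat]
  · simp only [sCoeffB1, map_add, map_sub, map_mul, map_neg, map_pow, map_ofNat]
  · simp only [sCoeffB0, map_add, map_sub, map_mul, map_neg, map_pow, map_ofNat]

theorem toFunction_sRaw : toFunction L A B (sRaw A B h k) =
    let κ := (coordC A B L).comp (algebraMap F L)
    let x := coordX A B L
    κ (sCoeffA4 A B h.slope h.const k.slope k.const) * x ^ 4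
      + κ (sCoeffA3 A B h.slope h.const k.slope k.const) * x ^ 3
      + κ (sCoeffA2 A B h.slope h.const k.slope k.const) * x ^ 2
      + κ (sCoeffA1 A B h.slope h.const k.slope k.const) * x
      + κ (sCoeffA0 A B h.slope h.const k.slope k.const)
      + coordY A B L * (κ (sCoeffB3 A B h.slope h.const k.slope k.const) * x ^ 3
      + κ (sCoeffB2 A B h.slope h.const k.slope k.const) * x ^ 2
      + κ (sCoeffB1 A B h.slope h.const k.slope k.const) * x
      + κ (sCoeffB0 A B h.slope h.const k.slope k.const)) := by
  simp [toFunction, sRaw, coordX, coordY, coordC]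

/-- Up to the cubes of two lines, `S_{Q,R}` is the product of the lines through the conjugates of
`-Q` and `-R`. -/
theorem prod_prod_lineDet_eq (h2 : (2 : F) ≠ 0) {z u : Fin 3 → L}
    (hz : IsIntersection (algebraMap F L A) (algebraMap F L B) (algebraMap F L h.slope)
      (algebraMap F L h.const) z)
    (hu : IsIntersection (algebraMap F L A) (algebraMap F L B) (algebraMap F L k.slope)
      (algebraMap F L k.const) u) :
    ∏ j, ∏ i, lineDet (coordX A B L) (coordY A B L) (coordC A B L (z i))
        (coordC A B L (-(algebraMap F L h.slope * z i + algebraMap F L h.const)))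
        (coordC A B L (u j))
        (coordC A B L (-(algebraMap F L k.slope * u j + algebraMap F L k.const))) =
      -(h.neg.toFunction A B L * k.neg.toFunction A B L) ^ 3 *
        (coordC A B L (algebraMap F L (sCoeffB3 A B h.slope h.const (-k.slope) (-k.const))) *
          toFunction L A B (sRaw A B h k)) := by
  -- The coefficient formulas are stated over a field, so the identity is applied to the generic
  -- point, with coordinates in the function field.
  let K := FractionRing (CoordinateRing ((curve A B)⁄L))
  let ι : CoordinateRing ((curve A B)⁄L) →+* K := algebraMap _ _
  have hι : Function.Injective ι := IsFractionRing.injective _ _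
  let κ := coordC A B L
  let ψ : F →+* K := (ι.comp κ).comp (algebraMap F L)
  have h2' : (2 : K) ≠ 0 := by
    have := (_root_.map_ne_zero ψ).2 h2
    rwa [map_ofNat] at this
  have key := prod_prod_lineDet h2' (x := ι (coordX A B L)) (y := ι (coordY A B L))
    (hz.map (ι.comp κ)) (hu.map (ι.comp κ)) (by
      rw [← map_pow, coordY_sq]; simp only [map_add, map_mul, map_pow]; rfl)
  apply hι
  obtain ⟨e₁, e₂, e₃, e₄, e₅, e₆, e₇, e₈, e₉⟩ := map_sCoeff ψ A B h.slope h.const k.slope k.const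
  obtain ⟨-, -, -, -, -, e, -⟩ := map_sCoeff ψ A B h.slope h.const (-k.slope) (-k.const)
  simp only [ψ, RingHom.comp_apply, map_neg] at e e₁ e₂ e₃ e₄ e₅ e₆ e₇ e₈ e₉
  simp only [RingHom.comp_apply, Function.comp_apply, ← e, ← e₁, ← e₂, ← e₃, ← e₄, ← e₅, ← e₆,
    ← e₇, ← e₈, ← e₉] at key
  rw [toFunction_sRaw]
  simp only [lineDet, Line.toFunction_neg, map_prod, map_mul, map_sub, map_add, map_pow,
    map_neg, RingHom.comp_apply] at key ⊢
  refine key.trans ?_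
  ring

end CoordinateRing

section

variable {F L : Type*} [Field F] [Fintype F] [Field L] [Algebra F L] [DecidableEq L] {A B : F}

/-- Up to the unit `z 1 - z 0`, this is the line through `Q` and `φ(Q)`, whose third point is `-(Q +
φ(Q)) = φ²(Q)`. -/
theorem LineOrbit.span_toFunction {h : Line F} {Q : ((curve A B)⁄L).Point} {z : Fin 3 → L}
    (hz : LineOrbit h Q z) (hQ : Q ∈ traceZero L A B) :
    Ideal.span {h.toFunction A B L} = ∏ i : Fin 3, pointIdeal ((frob A B)^[i] Q) := by
  obtain ⟨h₀, e₀⟩ := hz.eq_some 0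
  obtain ⟨h₁, e₁⟩ := hz.eq_some 1
  have hx : z 1 - z 0 ≠ 0 := sub_ne_zero.2 fun e => by simpa using hz.injective e
  have hne : WeierstrassCurve.Affine.Point.some _ _ h₀ ≠ .some _ _ h₁ := fun e =>
    hx (sub_eq_zero.2 (WeierstrassCurve.Affine.Point.some.inj e).1.symm)
  have key := span_lineDet h₀ h₁ hne
  rw [← e₀, ← e₁] at key
  have e₂ : (frob A B)^[(2 : Fin 3)] Q =
      -((frob A B)^[(0 : Fin 3)] Q + (frob A B)^[(1 : Fin 3)] Q) := frob_frob_eq hQ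
  rw [Fin.prod_univ_three, e₂, ← key,
    ← Ideal.span_singleton_mul_left_unit (isUnit_coordC (A := A) (B := B) hx)]
  congr 2
  simp only [Line.toFunction, lineDet, map_sub, map_add, map_mul]
  ring

theorem LineOrbit.neg {h : Line F} {Q : ((curve A B)⁄L).Point} {z : Fin 3 → L}
    (hz : LineOrbit h Q z) : LineOrbit h.neg (-Q) z := by
  refine ⟨fun i => ?_, hz.injective⟩
  obtain ⟨h₀, e₀⟩ := hz.eq_some i
  obtain ⟨h₁, e₁⟩ := neg_some_eq h₀
  have : -(algebraMap F L h.slope * z i + algebraMap F L h.const) =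
      algebraMap F L h.neg.slope * z i + algebraMap F L h.neg.const := by
    simp only [Line.neg, map_neg]
    ring
  rw [iterate_map_neg, e₀, e₁]
  simp only [this]
  exact ⟨this ▸ h₁, trivial⟩

theorem LineOrbit.isLineOf {h : Line F} {Q : ((curve A B)⁄L).Point} {z : Fin 3 → L}
    (hz : LineOrbit h Q z) : IsLineOf h Q := by
  have : ∀ i : Fin 3, h.Contains ((TraceZero.frob A B)^[i] Q) := fun i => by
    obtain ⟨hn, e⟩ := hz.eq_some i
    rw [e]
    rfl
  exact ⟨this 0, this 1, this 2⟩

theorem Line.Contains.of_iterate_frob {h : Line F} {Q : ((curve A B)⁄L).Point}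
    (hQ : Q ∈ traceZero L A B) {i : Fin 3} (hh : h.Contains ((frob A B)^[i] Q)) :
    h.Contains Q := by
  fin_cases i
  · exact hh
  · have := Line.contains_frob (Line.contains_frob hh)
    exact (frob_frob_frob hQ) ▸ this
  · have := Line.contains_frob hh
    exact (frob_frob_frob hQ) ▸ this

/-- By Vieta, `b₃ = ∏ (yᵢ + β₁ zᵢ + β₀)` over the points `(zᵢ, yᵢ)` on `h`. A vanishing factor puts
a conjugate of `Q` on `k.neg`, and the line of a point is unique. -/
theorem LineOrbit.sCoeffB3_ne_zero {h k : Line F} {Q : ((curve A B)⁄L).Point} {z : Fin 3 → L}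
    (hz : LineOrbit h Q z) (hQ : Q ∈ traceZero L A B) (hk : k ≠ h.neg) :
    sCoeffB3 A B h.slope h.const k.slope k.const ≠ 0 := by
  obtain ⟨s₁, s₂, s₃⟩ := hz.isIntersection
  intro hc
  have e : ∏ i, ((algebraMap F L h.slope + algebraMap F L k.slope) * z i +
      (algebraMap F L h.const + algebraMap F L k.const)) = 0 := by
    rw [← map_zero (algebraMap F L), ← hc, (map_sCoeff _ _ _ _ _ _ _).2.2.2.2.2.1,
      Fin.prod_univ_three, sCoeffB3]
    set α₁ := algebraMap F L h.slope
    set α₀ := algebraMap F L h.const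
    set β₁ := algebraMap F L k.slope
    set β₀ := algebraMap F L k.const
    linear_combination (α₁ + β₁) ^ 3 * s₃ + (α₁ + β₁) ^ 2 * (α₀ + β₀) * s₂ +
      (α₁ + β₁) * (α₀ + β₀) ^ 2 * s₁
  obtain ⟨i, -, hi⟩ := Finset.prod_eq_zero_iff.1 e
  obtain ⟨hn, hi'⟩ := hz.eq_some i
  have hcon : k.neg.Contains ((frob A B)^[i] Q) := by
    rw [hi']
    simp only [Line.Contains, Line.neg, map_neg]
    linear_combination hi
  rw [← hz.eq_of_contains _ (hcon.of_iterate_frob hQ), k.neg_neg] at hk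
  exact hk rfl

theorem prod_pow_three {M : Type*} [CommMonoid M] (a b : Fin 3 → M) (c : Fin 3 → Fin 3 → M) :
    ∏ j, ∏ i, (a i * b j * c i j) = ((∏ i, a i) * ∏ j, b j) ^ 3 * ∏ i, ∏ j, c i j := by
  simp only [Finset.prod_mul_distrib, Finset.prod_const, Finset.card_univ, Fintype.card_fin]
  rw [mul_pow, Finset.prod_pow, Finset.prod_comm (f := fun j i => c i j)]

/-- Take ideals in `prod_prod_lineDet_eq`: each of the nine lines contributes `-φⁱ(Q)`, `-φʲ(R)` and
`φⁱ(Q) + φʲ(R)`. The first two kinds form the cubes of the lines of `-Q` and `-R`, which cancel. -/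
theorem isS_sRaw (h2 : (2 : F) ≠ 0) {h k : Line F} {Q R : ((curve A B)⁄L).Point}
    {z u : Fin 3 → L} (hz : LineOrbit h Q z) (hu : LineOrbit k R u) (hQ : Q ∈ traceZero L A B)
    (hR : R ∈ traceZero L A B) (hne : h ≠ k) : IsS (sRaw A B h k) Q R := by
  have hc : sCoeffB3 A B h.slope h.const (-k.slope) (-k.const) ≠ 0 :=
    hz.sCoeffB3_ne_zero hQ (k := k.neg) fun e => hne (by rw [← h.neg_neg, ← e, k.neg_neg])
  have hz' := hz.neg
  have hu' := hu.neg
  have key := congrArg (fun a => Ideal.span {a})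
    (prod_prod_lineDet_eq h k h2 hz.isIntersection hu.isIntersection)
  have hdet : ∀ i j : Fin 3, Ideal.span {lineDet (coordX A B L) (coordY A B L) (coordC A B L (z i))
        (coordC A B L (-(algebraMap F L h.slope * z i + algebraMap F L h.const)))
        (coordC A B L (u j))
        (coordC A B L (-(algebraMap F L k.slope * u j + algebraMap F L k.const)))} =
      pointIdeal ((frob A B)^[i] (-Q)) * pointIdeal ((frob A B)^[j] (-R)) *
        pointIdeal ((frob A B)^[i] Q + (frob A B)^[j] R) := by
    intro i j
    obtain ⟨h₁, e₁⟩ := hz'.eq_some i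
    obtain ⟨h₂, e₂⟩ := hu'.eq_some j
    have hne' : WeierstrassCurve.Affine.Point.some _ _ h₁ ≠ .some _ _ h₂ := fun e => by
      have hc₁ := hz'.isLineOf.iterate i
      rw [e₁, e, ← e₂] at hc₁
      have := hu'.eq_of_contains _ (hc₁.of_iterate_frob (neg_mem hR))
      exact hne (by rw [← h.neg_neg, this, k.neg_neg])
    have key := span_lineDet h₁ h₂ hne'
    rw [← e₁, ← e₂, iterate_map_neg (frob A B) i Q, iterate_map_neg (frob A B) j R, ← neg_add,
      _root_.neg_neg] at key
    rw [iterate_map_neg, iterate_map_neg, ← key]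
    simp only [Line.neg, map_neg, map_add, map_mul]
    congr 3 <;> ring
  simp only [← Ideal.prod_span_singleton, hdet, prod_pow_three] at key
  rw [← hz'.span_toFunction (neg_mem hQ), ← hu'.span_toFunction (neg_mem hR),
    Ideal.span_singleton_mul_span_singleton, Ideal.span_singleton_pow,
    ← Ideal.span_singleton_neg, ← Ideal.span_singleton_mul_span_singleton,
    Ideal.span_singleton_mul_left_unit (isUnit_coordC ((_root_.map_ne_zero _).2 hc))] at key
  refine ((Ideal.span_singleton_mul_right_inj ?_).1 key).symm
  exact neg_ne_zero.2 (pow_ne_zero _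
    (mul_ne_zero h.neg.toFunction_ne_zero k.neg.toFunction_ne_zero))

end

/-! ### Zeros of `S` -/

section Zeros

variable {F L : Type*} [Field F] [Fintype F] [Field L] [Algebra F L] [DecidableEq L] {A B : F}

omit [Fintype F] [DecidableEq L] in
theorem toFunction_C_mul (S : F[X] × F[X]) (a : F) :
    toFunction L A B (C a * S.1, C a * S.2) =
      coordC A B L (algebraMap F L a) * toFunction L A B S := by
  simp only [toFunction, coordC, Polynomial.map_mul, map_C, RingHom.comp_apply, map_add,
    map_mul]
  ring

theorem isS_sPoly (h2 : (2 : F) ≠ 0) {h k : Line F} {Q R : ((curve A B)⁄L).Point}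
    {z u : Fin 3 → L} (hz : LineOrbit h Q z) (hu : LineOrbit k R u) (hQ : Q ∈ traceZero L A B)
    (hR : R ∈ traceZero L A B) (hne : h ≠ k) : IsS (sPoly A B h k) Q R := by
  have key := isS_sRaw h2 hz hu hQ hR hne
  rw [sPoly]
  split_ifs with hb
  · exact key
  · rw [IsS, toFunction_C_mul, Ideal.span_singleton_mul_left_unit
      (isUnit_coordC ((_root_.map_ne_zero _).2 (inv_ne_zero hb)))]
    exact key

/-- The zeros of `S_{P,Q}` are the points `φⁱ(P) + φʲ(Q)`. -/
theorem IsS.eval_eq_zero_iff {K : Type*} [Field K] [Algebra L K] [Algebra F K]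
    [IsScalarTower F L K] {S : F[X] × F[X]} {P Q : ((curve A B)⁄L).Point} (hS : IsS S P Q) {x y : K}
    (hxy : y ^ 2 = x ^ 3 + algebraMap F K A * x + algebraMap F K B) :
    aeval x S.1 + y * aeval x S.2 = 0 ↔ ∃ i j : Fin 3, ∃ x' y' h',
      (frob A B)^[i] P + (frob A B)^[j] Q = .some x' y' h' ∧
        algebraMap L K x' = x ∧ algebraMap L K y' = y := by
  -- Evaluation at `(x, y)`. In the field `K` a product of ideals vanishes only if a factor does,
  -- and the ideal of a point maps to zero only if the point is `(x, y)`.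
  let ev : WeierstrassCurve.Affine.CoordinateRing ((curve A B)⁄L) →+* K :=
    AdjoinRoot.lift (eval₂RingHom (algebraMap L K) x) y (by
      simp [WeierstrassCurve.Affine.polynomial, curve, ← IsScalarTower.algebraMap_apply, hxy]
      rw [eval₂_pow]
      simp)
  have hev : ev (toFunction L A B S) = aeval x S.1 + y * aeval x S.2 := by
    simp only [toFunction, ev, AdjoinRoot.lift_mk]
    simp [eval₂_map, aeval_def, ← IsScalarTower.algebraMap_eq]
    exact mul_comm _ _
  have hpt : ∀ R : ((curve A B)⁄L).Point, (pointIdeal R).map ev = ⊥ ↔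
      ∃ x' y' h', R = .some x' y' h' ∧ algebraMap L K x' = x ∧ algebraMap L K y' = y := by
    rintro (_ | ⟨x', y', h'⟩)
    · rw [show pointIdeal (.zero : ((curve A B)⁄L).Point) = ⊤ from rfl, Ideal.map_top]
      exact iff_of_false top_ne_bot (by rintro ⟨_, _, _, ⟨⟩, _⟩)
    · rw [pointIdeal, WeierstrassCurve.Affine.CoordinateRing.XYIdeal, Ideal.map_span,
        Ideal.span_eq_bot]
      have e₁ : ev (WeierstrassCurve.Affine.CoordinateRing.XClass ((curve A B)⁄L) x') =
          x - algebraMap L K x' := by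
        simp [ev, WeierstrassCurve.Affine.CoordinateRing.XClass]
      have e₂ : ev (WeierstrassCurve.Affine.CoordinateRing.YClass ((curve A B)⁄L) (C y')) =
          y - algebraMap L K y' := by
        simp [ev, WeierstrassCurve.Affine.CoordinateRing.YClass]
      rw [Set.image_pair, e₁, e₂]
      simp only [Set.mem_insert_iff, Set.mem_singleton_iff, forall_eq_or_imp, forall_eq,
        sub_eq_zero]
      constructor
      · rintro ⟨rfl, rfl⟩
        exact ⟨x', y', h', rfl, rfl, rfl⟩
      · rintro ⟨x'', y'', h'', e, rfl, rfl⟩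
        obtain ⟨rfl, rfl⟩ := WeierstrassCurve.Affine.Point.some.inj e
        exact ⟨rfl, rfl⟩
  have key := congrArg (Ideal.mapHom ev) hS
  simp only [map_prod, Ideal.mapHom_apply, Ideal.map_span, Set.image_singleton, hev] at key
  rw [← Ideal.span_singleton_eq_bot, key, ← Ideal.zero_eq_bot]
  simp only [Finset.prod_eq_zero_iff, Finset.mem_univ, true_and]
  simp only [Ideal.zero_eq_bot, hpt]

end Zeros

/-! ### The cubic of a line as a minimal polynomial -/

section Cubic

variable {F : Type*} [Field F] {A B : F}

/-- The monic cubic whose roots are the `x`-coordinates of the points on a line. -/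
def Line.cubic (A B : F) (h : Line F) : F[X] := TraceZero.cubic A B - h.rhs ^ 2

theorem Line.cubic_neg (h : Line F) : h.neg.cubic A B = h.cubic A B := by
  simp only [Line.cubic, Line.neg, Line.rhs, C_neg]
  ring

theorem Line.cubic_eq (h : Line F) : h.cubic A B = X ^ 3 + (C (-h.slope ^ 2) * X ^ 2 +
    C (A - 2 * h.slope * h.const) * X + C (B - h.const ^ 2)) := by
  simp only [Line.cubic, TraceZero.cubic, Line.rhs, C_sub, C_mul, C_neg, C_pow, C_ofNat]
  ring

theorem Line.cubic_monic (h : Line F) : (h.cubic A B).Monic := by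
  rw [h.cubic_eq]
  apply monic_X_pow_add
  compute_degree!

theorem Line.natDegree_cubic (h : Line F) : (h.cubic A B).natDegree = 3 := by
  rw [h.cubic_eq]
  compute_degree!

/-- Modulo the cubic of the line, `f` is the square of `h.rhs`, so the norm factors. -/
theorem Line.cubic_dvd_sigma {h : Line F} {S : F[X] × F[X]} (hS : h.cubic A B ∣ h.rhs * S.2 + S.1) :
    h.cubic A B ∣ sigma A B S := by
  have : sigma A B S = h.cubic A B * S.2 ^ 2 + (h.rhs * S.2 + S.1) * (h.rhs * S.2 - S.1) := by
    simp only [sigma, Line.cubic]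
    ring
  rw [this]
  exact dvd_add (dvd_mul_right _ _) (hS.mul_right _)

theorem aeval_cubic {K : Type*} [Field K] [Algebra F K] (x : K) :
    aeval x (cubic A B) = x ^ 3 + algebraMap F K A * x + algebraMap F K B := by
  simp [cubic]

theorem Line.aeval_rhs {K : Type*} [Field K] [Algebra F K] (h : Line F) (x : K) :
    aeval x h.rhs = algebraMap F K h.slope * x + algebraMap F K h.const := by
  simp [Line.rhs]

variable {L : Type*} [Fintype F] [Field L] [Algebra F L] [DecidableEq L]
variable {h : Line F} {Q : ((curve A B)⁄L).Point} {z : Fin 3 → L}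

/-- The degree of `z 0` divides 3 and is not 1, so a monic cubic vanishing at `z 0` is its minimal
polynomial. -/
theorem LineOrbit.cubic_eq_minpoly (hdeg : Module.finrank F L = 3) (hz : LineOrbit h Q z) :
    h.cubic A B = minpoly F (z 0) := by
  have : FiniteDimensional F L := .of_finrank_pos (by omega)
  have hint := IsIntegral.of_finite F (z 0)
  have h3 : (minpoly F (z 0)).natDegree = 3 := by
    have h₁ := minpoly.degree_dvd hint
    rw [hdeg, Nat.dvd_prime Nat.prime_three, minpoly.natDegree_eq_one_iff] at h₁
    exact h₁.resolve_left fun ⟨a, ha⟩ => hz.not_mem_range a ha.symm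
  obtain ⟨hn, -⟩ := hz.eq_some 0
  have hdvd : minpoly F (z 0) ∣ h.cubic A B := minpoly.dvd _ _ (by
    rw [Line.cubic, map_sub, map_pow, aeval_cubic, Line.aeval_rhs, curve_equation_iff.1 hn.1,
      sub_self])
  exact eq_of_monic_of_dvd_of_natDegree_le (minpoly.monic hint) h.cubic_monic hdvd
    (by rw [h3, h.natDegree_cubic])

theorem LineOrbit.irreducible_cubic (hdeg : Module.finrank F L = 3) (hz : LineOrbit h Q z) :
    Irreducible (h.cubic A B) := by
  have : FiniteDimensional F L := .of_finrank_pos (by omega)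
  rw [hz.cubic_eq_minpoly hdeg]
  exact minpoly.irreducible (.of_finite F _)

theorem LineOrbit.cubic_dvd_iff (hdeg : Module.finrank F L = 3) (hz : LineOrbit h Q z) (g : F[X]) :
    h.cubic A B ∣ g ↔ aeval (z 0) g = 0 := by
  rw [hz.cubic_eq_minpoly hdeg]
  exact minpoly.dvd_iff

/-- Divisibility by a minimal polynomial is vanishing at `z 0`, where `h.rhs` takes the value
`y(Q)`. -/
theorem LineOrbit.cubic_dvd_iff_exists (hdeg : Module.finrank F L = 3) (hz : LineOrbit h Q z)
    {S : F[X] × F[X]} {P R : ((curve A B)⁄L).Point} (hS : IsS S P R) :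
    h.cubic A B ∣ h.rhs * S.2 + S.1 ↔
      ∃ i j : Fin 3, Q = (frob A B)^[i] P + (frob A B)^[j] R := by
  obtain ⟨hn, e⟩ := hz.eq_some 0
  rw [hz.cubic_dvd_iff hdeg, show Q = _ from e, map_add, map_mul, add_comm, Line.aeval_rhs,
    hS.eval_eq_zero_iff (curve_equation_iff.1 hn.1)]
  refine exists_congr fun i => exists_congr fun j => ?_
  constructor
  · rintro ⟨_, _, h', e, rfl, rfl⟩
    exact e.symm
  · intro e
    exact ⟨_, _, hn, e.symm, rfl, rfl⟩

/-- The irreducible cubic factors of the norm of `S_{P,R}` come from its zeros. -/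
theorem IsS.exists_cubic_eq (hT : NoTwoThreeTorsion (traceZero L A B))
    (hdeg : Module.finrank F L = 3) {S : F[X] × F[X]} {P R : ((curve A B)⁄L).Point}
    (hS : IsS S P R) (hP : P ∈ traceZero L A B) (hR : R ∈ traceZero L A B) {W : F[X]}
    (hW : W.Monic) (hirr : Irreducible W) (hdvd : W ∣ sigma A B S) :
    ∃ (i j : Fin 3) (h : Line F), IsLineOf h ((frob A B)^[i] P + (frob A B)^[j] R) ∧
      W = h.cubic A B := by
  let K := AlgebraicClosure L
  obtain ⟨x, hx⟩ := IsAlgClosed.exists_aeval_eq_zero K W (degree_pos_of_irreducible hirr).ne'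
  have hs : aeval x (sigma A B S) = 0 := by
    obtain ⟨g, hg⟩ := hdvd
    rw [hg, map_mul, hx, zero_mul]
  rw [sigma, map_sub, map_mul, map_pow, map_pow, aeval_cubic] at hs
  -- A zero of the norm lifts to a zero of `S` on the curve: `y = -S₁(x) / S₂(x)`, or any square
  -- root of `f(x)` when `S₂(x) = 0`, since then `S₁(x) = 0` too.
  obtain ⟨y, hy, hy'⟩ : ∃ y : K, y ^ 2 = x ^ 3 + algebraMap F K A * x + algebraMap F K B ∧
      aeval x S.1 + y * aeval x S.2 = 0 := by
    by_cases h0 : aeval x S.2 = 0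
    · obtain ⟨y, hy⟩ := IsAlgClosed.exists_pow_nat_eq
        (x ^ 3 + algebraMap F K A * x + algebraMap F K B) (n := 2) (by norm_num)
      have h1 : aeval x S.1 = 0 := by simpa [h0] using hs
      exact ⟨y, hy, by rw [h0, h1]; ring⟩
    · refine ⟨-aeval x S.1 / aeval x S.2, ?_, by rw [div_mul_cancel₀ _ h0, add_neg_cancel]⟩
      rw [div_pow, div_eq_iff (pow_ne_zero 2 h0)]
      linear_combination -hs
  obtain ⟨i, j, x', y', h', e, rfl, -⟩ := (hS.eval_eq_zero_iff hy).1 hy'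
  have hQ : (frob A B)^[i] P + (frob A B)^[j] R ∈ traceZero L A B :=
    add_mem (iterate_frob_mem_traceZero hP _) (iterate_frob_mem_traceZero hR _)
  obtain ⟨h, hh⟩ := exists_isLineOf hT hQ
    (by rw [e]; exact WeierstrassCurve.Affine.Point.some_ne_zero _)
  refine ⟨i, j, h, hh, ?_⟩
  obtain ⟨z, hz⟩ := hh.lineOrbit hT hQ
  obtain ⟨hn, e'⟩ := hz.eq_some 0
  have hxz : x' = z 0 := (WeierstrassCurve.Affine.Point.some.inj (e.symm.trans e')).1
  rw [hz.cubic_eq_minpoly hdeg, ← hxz]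
  refine minpoly.eq_of_irreducible_of_monic hirr ?_ hW
  rw [aeval_algebraMap_apply] at hx
  exact (algebraMap L K).injective (hx.trans (map_zero _).symm)

end Cubic

/-! ### The linear system and the loop over cubic factors -/

section Solve

variable {F : Type*} [Field F]

theorem quartic_eq_iff {a₄ a₃ a₂ a₁ a₀ b₄ b₃ b₂ b₁ b₀ : F} :
    C a₄ * X ^ 4 + C a₃ * X ^ 3 + C a₂ * X ^ 2 + C a₁ * X + C a₀ =
      C b₄ * X ^ 4 + C b₃ * X ^ 3 + C b₂ * X ^ 2 + C b₁ * X + C b₀ ↔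
    a₄ = b₄ ∧ a₃ = b₃ ∧ a₂ = b₂ ∧ a₁ = b₁ ∧ a₀ = b₀ := by
  constructor
  · intro h
    refine ⟨?_, ?_, ?_, ?_, ?_⟩
    · simpa [coeff_X_pow] using congrArg (coeff · 4) h
    · simpa [coeff_X_pow] using congrArg (coeff · 3) h
    · simpa [coeff_X_pow] using congrArg (coeff · 2) h
    · simpa [coeff_X_pow] using congrArg (coeff · 1) h
    · simpa [coeff_X_pow] using congrArg (coeff · 0) h
  · rintro ⟨rfl, rfl, rfl, rfl, rfl⟩
    rfl

/-- The shape of a polynomial `S₁ + y S₂` whose divisor has a pole of order nine. -/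
structure IsGeneric (S : F[X] × F[X]) : Prop where
  fst_le : S.1.natDegree ≤ 4
  snd_le : S.2.natDegree ≤ 3
  coeff_three : S.2.coeff 3 = 1

theorem IsGeneric.snd_monic {S : F[X] × F[X]} (hS : IsGeneric S) : S.2.Monic :=
  monic_of_natDegree_le_of_coeff_eq_one 3 hS.snd_le hS.coeff_three

theorem IsGeneric.natDegree_snd {S : F[X] × F[X]} (hS : IsGeneric S) : S.2.natDegree = 3 :=
  natDegree_eq_of_le_of_coeff_ne_zero hS.snd_le (by rw [hS.coeff_three]; exact one_ne_zero)

/-- In `g.rhs * S.2 + S.1 = W * (d₁ X + d₀)`, the coefficient of `X⁴` forces `d₁ = a₄ + γ₁` and the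
constant one `d₀ = (a₀ + γ₀ b₀) / w₀`. The coefficients of `X³`, `X²`, `X`, multiplied by `w₀`, are
the three rows. -/
theorem solves_linSys_iff {W : F[X]} {S : F[X] × F[X]} (hS : IsGeneric S) (hW : W.Monic)
    (hW3 : W.natDegree = 3) (hW0 : W.coeff 0 ≠ 0) (g : Line F) :
    Solves (linSys W S) g ↔ W ∣ g.rhs * S.2 + S.1 := by
  have e₁ := S.1.as_sum_range_C_mul_X_pow' (n := 5) (by have := hS.fst_le; omega)
  have e₂ := S.2.as_sum_range_C_mul_X_pow' (n := 4) (by have := hS.snd_le; omega)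
  have e₃ := W.as_sum_range_C_mul_X_pow' (n := 4) (by omega)
  have hw : W.coeff 3 = 1 := by rw [← hW3]; exact hW
  simp only [Finset.sum_range_succ, Finset.range_zero, Finset.sum_empty, hS.coeff_three, hw,
    pow_zero, pow_one, C_1, one_mul, mul_one, zero_add] at e₁ e₂ e₃
  generalize hw₀ : W.coeff 0 = w₀ at *
  generalize hw₁ : W.coeff 1 = w₁ at *
  generalize hw₂ : W.coeff 2 = w₂ at *
  have hT : g.rhs * S.2 + S.1 = C (S.1.coeff 4 + g.slope) * X ^ 4 +
      C (S.1.coeff 3 + g.const + g.slope * S.2.coeff 2) * X ^ 3 +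
      C (S.1.coeff 2 + g.const * S.2.coeff 2 + g.slope * S.2.coeff 1) * X ^ 2 +
      C (S.1.coeff 1 + g.const * S.2.coeff 1 + g.slope * S.2.coeff 0) * X +
      C (S.1.coeff 0 + g.const * S.2.coeff 0) := by
    conv_lhs => rw [e₁, e₂]
    simp only [Line.rhs, C_add, C_mul]
    ring
  have hD : ∀ d₁ d₀ : F, W * (C d₁ * X + C d₀) = C d₁ * X ^ 4 + C (d₁ * w₂ + d₀) * X ^ 3 +
      C (d₁ * w₁ + d₀ * w₂) * X ^ 2 + C (d₁ * w₀ + d₀ * w₁) * X + C (d₀ * w₀) := fun d₁ d₀ => by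
    conv_lhs => rw [e₃]
    simp only [C_add, C_mul]
    ring
  have hsol : Solves (linSys W S) g ↔
      w₀ * (w₂ - S.2.coeff 2) * g.slope + (S.2.coeff 0 - w₀) * g.const =
        w₀ * S.1.coeff 3 - S.1.coeff 4 * w₂ * w₀ - S.1.coeff 0 ∧
      w₀ * (w₁ - S.2.coeff 1) * g.slope + (S.2.coeff 0 * w₂ - w₀ * S.2.coeff 2) * g.const =
        w₀ * S.1.coeff 2 - S.1.coeff 4 * w₁ * w₀ - S.1.coeff 0 * w₂ ∧
      w₀ * (w₀ - S.2.coeff 0) * g.slope + (S.2.coeff 0 * w₁ - S.2.coeff 1 * w₀) * g.const =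
        w₀ * S.1.coeff 1 - S.1.coeff 4 * w₀ ^ 2 - S.1.coeff 0 * w₁ := by
    simp only [Solves, linSys, Fin.forall_fin_succ, hw₀, hw₁, hw₂]
    simp
  rw [hsol]
  constructor
  · rintro ⟨h₁, h₂, h₃⟩
    refine ⟨C (S.1.coeff 4 + g.slope) * X + C ((S.1.coeff 0 + g.const * S.2.coeff 0) / w₀), ?_⟩
    rw [hT, hD, quartic_eq_iff]
    refine ⟨rfl, ?_, ?_, ?_, by field_simp⟩
    · field_simp
      linear_combination -h₁
    · field_simp
      linear_combination -h₂
    · field_simp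
      linear_combination -h₃
  · rintro ⟨D, hD'⟩
    have hdeg : D.natDegree ≤ 1 := by
      by_cases h0 : D = 0
      · simp [h0]
      have := hW.natDegree_mul' h0
      rw [← hD', hW3] at this
      have h4 : (g.rhs * S.2 + S.1).natDegree ≤ 4 := by
        rw [hT]
        compute_degree
      omega
    obtain ⟨d₁, d₀, rfl⟩ := exists_eq_X_add_C_of_natDegree_le_one hdeg
    rw [hT, hD, quartic_eq_iff] at hD'
    obtain ⟨rfl, h₃, h₂, h₁, h₀⟩ := hD'
    refine ⟨?_, ?_, ?_⟩
    · linear_combination w₀ * -h₃ + h₀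
    · linear_combination w₀ * -h₂ + w₂ * h₀
    · linear_combination w₀ * -h₁ + w₁ * h₀

theorem solve_eq_some {M : Matrix (Fin 3) (Fin 3) F} {h : Line F} (hh : Solves M h)
    (hu : ∀ g, Solves M g → g = h) : solve M = some h := by
  have e : ∃! g, Solves M g := ⟨h, hh, hu⟩
  rw [solve, dif_pos e, hu _ e.choose_spec.1]

theorem coeff_zero_ne_zero_of_irreducible {W : F[X]} (hW : Irreducible W) (hd : 1 < W.natDegree) :
    W.coeff 0 ≠ 0 := fun h0 => by
  have := natDegree_le_of_dvd (irreducible_X.dvd_symm hW (X_dvd_iff.2 h0)) X_ne_zero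
  rw [natDegree_X] at this
  omega

variable {A B : F}

/-- For two solutions the prime `W` divides `(g.rhs - h.rhs) * S.2`. It does not divide `S.2`, a
different monic cubic, so it divides a polynomial of degree at most one, which must vanish. -/
theorem solve_linSys {S : F[X] × F[X]} (hS : IsGeneric S) {h : Line F}
    (hirr : Irreducible (h.cubic A B)) (hne : h.cubic A B ≠ S.2)
    (hdvd : h.cubic A B ∣ h.rhs * S.2 + S.1) : solve (linSys (h.cubic A B) S) = some h := by
  have h0 := coeff_zero_ne_zero_of_irreducible hirr (by rw [h.natDegree_cubic]; norm_num)
  have key := solves_linSys_iff hS h.cubic_monic h.natDegree_cubic h0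
  refine solve_eq_some ((key h).2 hdvd) fun g hg => ?_
  have hsub := dvd_sub ((key g).1 hg) hdvd
  rw [add_sub_add_right_eq_sub, ← sub_mul] at hsub
  rcases hirr.prime.dvd_or_dvd hsub with h₁ | h₁
  · have hd : (g.rhs - h.rhs).natDegree < (h.cubic A B).natDegree := by
      rw [h.natDegree_cubic, Line.rhs, Line.rhs]
      refine lt_of_le_of_lt (b := 1) ?_ (by norm_num)
      compute_degree
    have h₂ := eq_zero_of_dvd_of_natDegree_lt h₁ hd
    rw [Line.rhs, Line.rhs, sub_eq_zero] at h₂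
    refine Line.ext ?_ ?_
    · simpa using congrArg (coeff · 1) h₂
    · simpa using congrArg (coeff · 0) h₂
  · exact absurd (eq_of_monic_of_dvd_of_natDegree_le h.cubic_monic hS.snd_monic h₁
      (by rw [hS.natDegree_snd, h.natDegree_cubic])).symm hne

/-- Here `W` divides `S.1` as well, so `S` vanishes over all roots of `W`, whatever the sign of `y`.
-/
theorem dvd_of_dvd_sigma {S : F[X] × F[X]} {W : F[X]} (hW : Irreducible W) (hdvd : W ∣ sigma A B S)
    (hS : W ∣ S.2) (g : F[X]) : W ∣ g * S.2 + S.1 := by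
  refine dvd_add (hS.mul_left _) (hW.prime.dvd_of_dvd_pow (n := 2) ?_)
  have : S.1 ^ 2 = cubic A B * S.2 ^ 2 - sigma A B S := by rw [sigma]; ring
  rw [this]
  exact dvd_sub ((hS.pow two_ne_zero).mul_left _) hdvd

/-- The term `f S₂²` has degree 9, while `S₁²` has degree at most 8. -/
theorem IsGeneric.sigma_ne_zero {S : F[X] × F[X]} (hS : IsGeneric S) : sigma A B S ≠ 0 := by
  have hc : (cubic A B).natDegree = 3 := by rw [cubic]; compute_degree!
  have hm : (cubic A B).Monic := by
    rw [cubic, add_assoc]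
    apply monic_X_pow_add
    compute_degree!
  have h₁ : (cubic A B * S.2 ^ 2).natDegree = 9 := by
    rw [hm.natDegree_mul (hS.snd_monic.pow 2), hS.snd_monic.natDegree_pow, hS.natDegree_snd, hc]
  have h₂ : (S.1 ^ 2).natDegree ≤ 8 := natDegree_pow_le_of_le 2 hS.fst_le
  intro e
  rw [sigma, sub_eq_zero] at e
  rw [e] at h₁
  omega

theorem mem_cubicFactors_iff {G W : F[X]} (hG : G ≠ 0) :
    W ∈ cubicFactors G ↔ W.Monic ∧ Irreducible W ∧ W ∣ G ∧ W.natDegree = 3 := by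
  classical
  simp only [cubicFactors, Finset.mem_filter, Multiset.mem_toFinset,
    UniqueFactorizationMonoid.mem_normalizedFactors_iff' hG]
  constructor
  · rintro ⟨⟨h₁, h₂, h₃⟩, h₄⟩
    exact ⟨h₂ ▸ monic_normalize h₁.ne_zero, h₁, h₃, h₄⟩
  · rintro ⟨h₁, h₂, h₃, h₄⟩
    exact ⟨⟨h₂, h₁.normalize_eq_self, h₃⟩, h₄⟩

theorem monicOf_eq {g W : F[X]} (hg : g ≠ 0) (hW : W.Monic) (hd : g.natDegree ≤ W.natDegree)
    (hdvd : W ∣ g) : monicOf g = W := by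
  refine (eq_of_monic_of_dvd_of_natDegree_le hW ?_ ?_ ?_)
  · rw [monicOf, mul_comm]; exact monic_mul_leadingCoeff_inv hg
  · exact hdvd.mul_left _
  · exact (natDegree_C_mul_le _ _).trans hd

/-- The lines `h` in `V` whose points are zeros of `S` account for all cubic factors of the norm
of `S`. -/
structure HasCubicFactors (A B : F) (V : Set (Line F)) (S : F[X] × F[X]) : Prop where
  exists_line : ∀ W : F[X], W.Monic → Irreducible W → W ∣ sigma A B S →
    ∃ h ∈ V, W = h.cubic A B ∧ h.cubic A B ∣ h.rhs * S.2 + S.1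

theorem factorLoop_eq_some {V : Set (Line F)} (hV : ∀ h ∈ V, h.neg ∈ V)
    (hirr : ∀ h ∈ V, Irreducible (h.cubic A B)) {S₁ S₂ : F[X] × F[X]} (hS₁ : IsGeneric S₁)
    (hS₂ : IsGeneric S₂) (hf₁ : HasCubicFactors A B V S₁) (hf₂ : HasCubicFactors A B V S₂)
    {h : Line F} (hh : h ∈ V) (hneg : h.neg ≠ h) (hd₁ : h.cubic A B ∣ h.rhs * S₁.2 + S₁.1)
    (hd₂ : h.cubic A B ∣ h.rhs * S₂.2 + S₂.1)
    (hcommon : ∀ g ∈ V, g.cubic A B ∣ g.rhs * S₁.2 + S₁.1 → g.cubic A B ∣ g.rhs * S₂.2 + S₂.1 →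
      g = h) (l : List F[X])
    (hl : ∀ W ∈ l, W.Monic ∧ Irreducible W ∧ W ∣ sigma A B S₁ ∧ W ∣ sigma A B S₂)
    (hmem : h.cubic A B ∈ l) : factorLoop S₁ S₂ l = some h := by
  induction l with
  | nil => simp at hmem
  | cons W l ih =>
    obtain ⟨hm, hi, hs₁, hs₂⟩ := hl W List.mem_cons_self
    rw [factorLoop]
    split_ifs with hW
    · obtain ⟨g, hg, rfl, hgd⟩ := hf₁.exists_line W hm hi hs₁
      by_cases hgh : h.cubic A B = g.cubic A B
      · rw [← hgh] at hW ⊢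
        rw [solve_linSys hS₁ (hirr h hh) hW hd₁]
        exact if_pos hd₂
      -- The factor belongs to a zero `g` of `S₁` that is not one of `S₂`; the divisibility test
      -- rejects it and the loop goes on.
      · rw [solve_linSys hS₁ hi hW hgd]
        have : ¬ g.cubic A B ∣ g.rhs * S₂.2 + S₂.1 := fun hd => hgh (by rw [hcommon g hg hgd hd])
        simp only [if_neg this]
        exact ih (fun W hW => hl W (List.mem_cons_of_mem _ hW))
          ((List.mem_cons.1 hmem).resolve_left hgh)
    · obtain ⟨g, hg, rfl, hgd⟩ := hf₂.exists_line W hm hi hs₂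
      have hW' : g.cubic A B = S₁.2 := not_not.1 hW
      -- Now `S₁` vanishes at the points of `g` and of `g.neg`. The first makes `g` the common line;
      -- were `W = S₂.2` too, `g.neg` would be another one.
      have h₁ := dvd_of_dvd_sigma hi hs₁ (dvd_of_eq hW')
      obtain rfl := hcommon g hg (h₁ _) hgd
      refine solve_linSys hS₂ hi (fun e => hneg ?_) hgd
      have h₂ := dvd_of_dvd_sigma hi hs₂ (dvd_of_eq e)
      exact hcommon _ (hV _ hg) (by rw [Line.cubic_neg]; exact h₁ _)
        (by rw [Line.cubic_neg]; exact h₂ _)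

/-- With no `y`-part, `S₁` is a polynomial in `x` of degree at most 3 divisible by the cubic of `h`,
hence a multiple of it. It vanishes for `h.neg` too, so the cubic cannot divide `S₂.2`; in
particular `S₂.2 ≠ 0`. -/
theorem solve_linSys_monicOf {V : Set (Line F)} (hV : ∀ h ∈ V, h.neg ∈ V)
    (hirr : ∀ h ∈ V, Irreducible (h.cubic A B)) {S₁ S₂ : F[X] × F[X]} (hS₁ : S₁.2 = 0)
    (hS₁' : S₁.1.natDegree ≤ 3) (hS₁0 : S₁.1 ≠ 0) (hS₂ : S₂.2 = 0 ∨ IsGeneric S₂)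
    {h : Line F} (hh : h ∈ V) (hneg : h.neg ≠ h) (hd₁ : h.cubic A B ∣ h.rhs * S₁.2 + S₁.1)
    (hd₂ : h.cubic A B ∣ h.rhs * S₂.2 + S₂.1)
    (hcommon : ∀ g ∈ V, g.cubic A B ∣ g.rhs * S₁.2 + S₁.1 → g.cubic A B ∣ g.rhs * S₂.2 + S₂.1 →
      g = h) : solve (linSys (monicOf S₁.1) S₂) = some h := by
  have hi := hirr h hh
  have hd₁' : h.cubic A B ∣ S₁.1 := by simpa [hS₁] using hd₁
  rw [monicOf_eq hS₁0 h.cubic_monic (by rw [h.natDegree_cubic]; exact hS₁') hd₁']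
  have hnot : ¬ h.cubic A B ∣ S₂.2 := fun e => hneg (hcommon _ (hV _ hh)
    (by rw [Line.cubic_neg, hS₁, mul_zero, zero_add]; exact hd₁')
    (by rw [Line.cubic_neg]; exact dvd_of_dvd_sigma hi (Line.cubic_dvd_sigma hd₂) e _))
  rcases hS₂ with hS₂ | hS₂
  · exact absurd (hS₂ ▸ dvd_zero _) hnot
  · exact solve_linSys hS₂ hi (fun e => hnot (dvd_of_eq e)) hd₂

theorem isGeneric_sPoly {h k : Line F}
    (hc : sCoeffB3 A B h.slope h.const k.slope k.const ≠ 0) : IsGeneric (sPoly A B h k) := by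
  have hb : (sRaw A B h k).2.coeff 3 = sCoeffB3 A B h.slope h.const k.slope k.const := by
    simp [sRaw, coeff_X_pow]
  have h₁ : (sRaw A B h k).1.natDegree ≤ 4 := by
    have h (a b c d e : F) :
        (C a * X ^ 4 + C b * X ^ 3 + C c * X ^ 2 + C d * X + C e).natDegree ≤ 4 := by
      compute_degree
    exact h ..
  have h₂ : (sRaw A B h k).2.natDegree ≤ 3 := natDegree_cubic_le
  rw [sPoly]
  generalize sRaw A B h k = S at *
  have hS : S.2.coeff 3 ≠ 0 := by rwa [hb]
  simp only [if_neg hS]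
  refine ⟨(natDegree_C_mul_le _ _).trans h₁, (natDegree_C_mul_le _ _).trans h₂, ?_⟩
  rw [coeff_C_mul, inv_mul_cancel₀ hS]

/-- For opposite lines three of the nine points are `P_∞`, which lowers the pole order from 9 to 6.
-/
theorem sPoly_neg (h : Line F) :
    (sPoly A B h.neg h).2 = 0 ∧ (sPoly A B h.neg h).1.natDegree ≤ 3 := by
  have e₄ : sCoeffA4 A B (-h.slope) (-h.const) h.slope h.const = 0 := by rw [sCoeffA4]; ring
  have e₃ : sCoeffB3 A B (-h.slope) (-h.const) h.slope h.const = 0 := by rw [sCoeffB3]; ring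
  have e₂ : sCoeffB2 A B (-h.slope) (-h.const) h.slope h.const = 0 := by rw [sCoeffB2]; ring
  have e₁ : sCoeffB1 A B (-h.slope) (-h.const) h.slope h.const = 0 := by rw [sCoeffB1]; ring
  have e₀ : sCoeffB0 A B (-h.slope) (-h.const) h.slope h.const = 0 := by rw [sCoeffB0]; ring
  have hr : (sRaw A B h.neg h).2 = 0 := by simp [sRaw, Line.neg, e₃, e₂, e₁, e₀]
  rw [sPoly]
  simp only [hr, coeff_zero, if_true, true_and]
  simp only [sRaw, Line.neg, e₄, C_0, zero_mul, zero_add]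
  compute_degree

end Solve

/-! ### Common zeros and correctness of the subalgorithm -/

section

variable {F L : Type*} [Field F] [Fintype F] [Field L] [Algebra F L] [DecidableEq L] {A B : F}

/-- Here `R` is `φ(Q)` or `φ²(Q)`, and the sum of two conjugates is the negative of the third. -/
theorem IsLineOf.neg_add (hT : NoTwoThreeTorsion (traceZero L A B)) {h : Line F}
    {Q R : ((curve A B)⁄L).Point} (hh : IsLineOf h Q) (hk : IsLineOf h R)
    (hQ : Q ∈ traceZero L A B) (hne : Q ≠ R) : IsLineOf h.neg (Q + R) := by
  obtain ⟨z, hz⟩ := hh.lineOrbit hT hQ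
  obtain ⟨i, rfl⟩ := hz.eq_iterate hk.1
  have hff := frob_frob_eq hQ
  fin_cases i
  · exact absurd rfl hne
  · have := hh.frob.frob.neg
    rwa [hff, _root_.neg_neg] at this
  · have : Q + TraceZero.frob A B (TraceZero.frob A B Q) = -TraceZero.frob A B Q := by
      rw [hff]; abel
    change IsLineOf h.neg (Q + TraceZero.frob A B (TraceZero.frob A B Q))
    rw [this]
    exact hh.frob.neg

/-- Conjugate points have the same line, and `φ³` is the identity on the trace-zero subgroup; the
subtraction `j - i` is modulo 3. -/
theorem isLineOf_iterate_add_iff {h : Line F} {Q R : ((curve A B)⁄L).Point}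
    (hQ : Q ∈ traceZero L A B) (hR : R ∈ traceZero L A B) (i j : Fin 3) :
    IsLineOf h ((frob A B)^[i] Q + (frob A B)^[j] R) ↔
      IsLineOf h (Q + (frob A B)^[(j - i : Fin 3)] R) := by
  rw [← isLineOf_iterate_frob_iff (add_mem hQ (iterate_frob_mem_traceZero hR _)) i,
    iterate_map_add, ← Function.iterate_add_apply]
  have : (frob A B)^[i + (j - i : Fin 3)] R = (frob A B)^[j] R := by
    fin_cases i <;> fin_cases j <;>
      first | rfl | exact frob_frob_frob hR | exact frob_frob_frob (frob_mem_traceZero hR)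
  rw [this]

theorem IsS.ne_zero {S : F[X] × F[X]} {Q R : ((curve A B)⁄L).Point} (hS : IsS S Q R) : S ≠ 0 := by
  rintro rfl
  have h0 : toFunction L A B 0 = 0 := by simp [toFunction]
  rw [IsS, h0, Ideal.span_singleton_eq_bot.2 rfl, ← Ideal.zero_eq_bot, eq_comm] at hS
  simp only [Finset.prod_eq_zero_iff, Finset.mem_univ, true_and] at hS
  obtain ⟨i, j, e⟩ := hS
  generalize (frob A B)^[i] Q + (frob A B)^[j] R = Z at e
  rcases Z with _ | ⟨x, y, hxy⟩
  · exact top_ne_bot e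
  · refine WeierstrassCurve.Affine.CoordinateRing.XClass_ne_zero (W' := (curve A B)⁄L) x ?_
    have := Ideal.subset_span (Set.mem_insert
      (WeierstrassCurve.Affine.CoordinateRing.XClass ((curve A B)⁄L) x)
      {WeierstrassCurve.Affine.CoordinateRing.YClass ((curve A B)⁄L) (C y)})
    change _ ∈ pointIdeal (.some x y hxy) at this
    rw [e] at this
    exact this

/-- The lines of the points of trace zero. -/
def traceZeroLines (L : Type*) [Field L] [Algebra F L] [DecidableEq L] (A B : F) : Set (Line F) :=
  {h | ∃ Q ∈ traceZero L A B, IsLineOf h Q}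

theorem neg_mem_traceZeroLines {h : Line F} (hh : h ∈ traceZeroLines L A B) :
    h.neg ∈ traceZeroLines L A B := by
  obtain ⟨Q, hQ, hl⟩ := hh
  exact ⟨-Q, neg_mem hQ, hl.neg⟩

variable (hT : NoTwoThreeTorsion (traceZero L A B))
include hT

theorem IsLineOf.unique {h k : Line F} {Q : ((curve A B)⁄L).Point} (hh : IsLineOf h Q)
    (hk : IsLineOf k Q) (hQ : Q ∈ traceZero L A B) : h = k := by
  obtain ⟨z, hz⟩ := hk.lineOrbit hT hQ
  exact hz.eq_of_contains _ hh.1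

/-- A line equal to its negative would give `y(Q) = -y(Q)`, so `Q` would have order two. -/
theorem IsLineOf.neg_ne {h : Line F} {Q : ((curve A B)⁄L).Point} (hh : IsLineOf h Q)
    (hQ : Q ∈ traceZero L A B) : h.neg ≠ h := fun e => by
  obtain ⟨x, hx, hQx⟩ := hh.1.exists_eq
  obtain ⟨h', e'⟩ := neg_some_eq hx
  refine ne_neg_self hT hQ hh.ne_zero ?_
  have h₁ := hh.1
  rw [← e, hQx] at h₁
  have h₂ : algebraMap F L h.slope * x + algebraMap F L h.const =
    algebraMap F L h.neg.slope * x + algebraMap F L h.neg.const := h₁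
  rw [hQx, e', WeierstrassCurve.Affine.Point.some.injEq]
  refine ⟨rfl, h₂.trans ?_⟩
  simp only [Line.neg, map_neg]
  ring

theorem irreducible_cubic_of_mem_traceZeroLines (hdeg : Module.finrank F L = 3) {h : Line F}
    (hh : h ∈ traceZeroLines L A B) : Irreducible (h.cubic A B) := by
  obtain ⟨Q, hQ, hl⟩ := hh
  obtain ⟨z, hz⟩ := hl.lineOrbit hT hQ
  exact hz.irreducible_cubic hdeg

theorem IsLineOf.cubic_dvd_iff (hdeg : Module.finrank F L = 3) {h : Line F}
    {Q P R : ((curve A B)⁄L).Point} (hh : IsLineOf h Q) (hQ : Q ∈ traceZero L A B)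
    {S : F[X] × F[X]} (hS : IsS S P R) :
    h.cubic A B ∣ h.rhs * S.2 + S.1 ↔
      ∃ i j : Fin 3, Q = (TraceZero.frob A B)^[i] P + (TraceZero.frob A B)^[j] R := by
  obtain ⟨z, hz⟩ := hh.lineOrbit hT hQ
  exact hz.cubic_dvd_iff_exists hdeg hS

theorem IsS.hasCubicFactors (hdeg : Module.finrank F L = 3) {P R : ((curve A B)⁄L).Point}
    {S : F[X] × F[X]} (hS : IsS S P R) (hP : P ∈ traceZero L A B) (hR : R ∈ traceZero L A B) :
    HasCubicFactors A B (traceZeroLines L A B) S where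
  exists_line W hm hi hd := by
    obtain ⟨i, j, h, hh, rfl⟩ := hS.exists_cubic_eq hT hdeg hP hR hm hi hd
    have hQ := add_mem (iterate_frob_mem_traceZero hP i) (iterate_frob_mem_traceZero hR j)
    exact ⟨h, ⟨_, hQ, hh⟩, rfl, (hh.cubic_dvd_iff hT hdeg hQ hS).2 ⟨i, j, rfl⟩⟩

theorem IsLineOf.isS_sPoly (h2 : (2 : F) ≠ 0) {h k : Line F} {Q R : ((curve A B)⁄L).Point}
    (hh : IsLineOf h Q) (hk : IsLineOf k R) (hQ : Q ∈ traceZero L A B)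
    (hR : R ∈ traceZero L A B) (hne : h ≠ k) : IsS (sPoly A B h k) Q R := by
  obtain ⟨z, hz⟩ := hh.lineOrbit hT hQ
  obtain ⟨u, hu⟩ := hk.lineOrbit hT hR
  exact TraceZero.isS_sPoly h2 hz hu hQ hR hne

theorem IsLineOf.isGeneric_sPoly {h k : Line F} {Q : ((curve A B)⁄L).Point} (hh : IsLineOf h Q)
    (hQ : Q ∈ traceZero L A B) (hne : h ≠ k.neg) : IsGeneric (sPoly A B h k) := by
  obtain ⟨z, hz⟩ := hh.lineOrbit hT hQ
  refine TraceZero.isGeneric_sPoly (hz.sCoeffB3_ne_zero hQ fun e => hne ?_)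
  rw [e, h.neg_neg]

/-- The only points that are zeros both of `S_{Q,R}` and of `S_{Q',R'}` lie on the line of
`Q + R = Q' + R'`. -/
theorem eq_of_common_zero {Q R Q' R' : ((curve A B)⁄L).Point} (hQ : Q ∈ traceZero L A B)
    (hR : R ∈ traceZero L A B) (hQ' : Q' ∈ traceZero L A B) (hR' : R' ∈ traceZero L A B)
    (hadd : Q + R = Q' + R')
    (hgeneric : ∀ i ∈ ({1, 2} : Set ℕ), ∀ j ∈ ({1, 2} : Set ℕ), ∀ h k : Line F,
      IsLineOf h (Q + (frob A B)^[i] R) → IsLineOf k (Q' + (frob A B)^[j] R') → h ≠ k)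
    {h g : Line F} (hh : IsLineOf h (Q + R)) {Z : ((curve A B)⁄L).Point} (hg : IsLineOf g Z)
    (hZ : ∃ i j : Fin 3, Z = (frob A B)^[i] Q + (frob A B)^[j] R)
    (hZ' : ∃ i j : Fin 3, Z = (frob A B)^[i] Q' + (frob A B)^[j] R') : g = h := by
  obtain ⟨i, j, e⟩ := hZ
  obtain ⟨k, l, e'⟩ := hZ'
  have h₁ := (isLineOf_iterate_add_iff hQ hR i j).1 (e ▸ hg)
  have h₂ := (isLineOf_iterate_add_iff hQ' hR' k l).1 (e' ▸ hg)
  have hval : ∀ d : Fin 3, d ≠ 0 → (d : ℕ) ∈ ({1, 2} : Set ℕ) := by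
    intro d
    fin_cases d <;> simp
  -- The difference `j - i` selects the orbit of `Q + φᵈ(R)`. Genericity excludes the case of two
  -- nonzero differences; a zero difference on either side already means the orbit of `Q + R = Q' +
  -- R'`.
  by_cases hd : j - i = 0
  · rw [hd] at h₁
    exact h₁.unique hT hh (add_mem hQ hR)
  by_cases hd' : l - k = 0
  · rw [hd'] at h₂
    exact h₂.unique hT (hadd ▸ hh) (add_mem hQ' hR')
  · exact absurd rfl (hgeneric _ (hval _ hd) _ (hval _ hd') g g h₁ h₂)

theorem subalgorithm_eq_some (h2 : (2 : F) ≠ 0) (hdeg : Module.finrank F L = 3)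
    {Q R Q' R' : ((curve A B)⁄L).Point} (hQ : Q ∈ traceZero L A B)
    (hR : R ∈ traceZero L A B) (hQ' : Q' ∈ traceZero L A B) (hR' : R' ∈ traceZero L A B)
    (hadd : Q + R = Q' + R') (hQR : Q ≠ R) (hQR' : Q' ≠ R') {h₁ h₂ k₁ k₂ h : Line F}
    (hh₁ : IsLineOf h₁ Q) (hh₂ : IsLineOf h₂ R) (hk₁ : IsLineOf k₁ Q') (hk₂ : IsLineOf k₂ R')
    (hh : IsLineOf h (Q + R))
    (hgeneric : ∀ i ∈ ({1, 2} : Set ℕ), ∀ j ∈ ({1, 2} : Set ℕ), ∀ h k : Line F,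
      IsLineOf h (Q + (frob A B)^[i] R) → IsLineOf k (Q' + (frob A B)^[j] R') → h ≠ k)
    (order : Finset F[X] → List F[X]) (horder : ∀ s W, W ∈ order s ↔ W ∈ s) :
    subalgorithm A B order h₁ h₂ k₁ k₂ = some h := by
  have hM : Q + R ∈ traceZero L A B := add_mem hQ hR
  have hM' : Q' + R' ∈ traceZero L A B := add_mem hQ' hR'
  have hh' : IsLineOf h (Q' + R') := hadd ▸ hh
  rw [subalgorithm]
  by_cases hc₁ : h₁ = h₂
  · rw [if_pos hc₁, (hh₁.neg_add hT (hc₁ ▸ hh₂) hQ hQR).unique hT hh hM]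
  by_cases hc₂ : k₁ = k₂
  · rw [if_neg hc₁, if_pos hc₂, (hk₁.neg_add hT (hc₂ ▸ hk₂) hQ' hQR').unique hT hh' hM']
  rw [if_neg hc₁, if_neg hc₂]
  have hS₁ := hh₁.isS_sPoly hT h2 hh₂ hQ hR hc₁
  have hS₂ := hk₁.isS_sPoly hT h2 hk₂ hQ' hR' hc₂
  have hV : ∀ g ∈ traceZeroLines L A B, g.neg ∈ traceZeroLines L A B :=
    fun _ => neg_mem_traceZeroLines
  have hirr : ∀ g ∈ traceZeroLines L A B, Irreducible (g.cubic A B) :=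
    fun _ => irreducible_cubic_of_mem_traceZeroLines hT hdeg
  have hmem : h ∈ traceZeroLines L A B := ⟨_, hM, hh⟩
  have hneg := hh.neg_ne hT hM
  have hd₁ := (hh.cubic_dvd_iff hT hdeg hM hS₁).2 ⟨0, 0, rfl⟩
  have hd₂ := (hh'.cubic_dvd_iff hT hdeg hM' hS₂).2 ⟨0, 0, rfl⟩
  have hcommon : ∀ g ∈ traceZeroLines L A B,
      g.cubic A B ∣ g.rhs * (sPoly A B h₁ h₂).2 + (sPoly A B h₁ h₂).1 →
      g.cubic A B ∣ g.rhs * (sPoly A B k₁ k₂).2 + (sPoly A B k₁ k₂).1 → g = h := by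
    rintro g ⟨Z, hZ, hg⟩ hg₁ hg₂
    exact eq_of_common_zero hT hQ hR hQ' hR' hadd hgeneric hh hg
      ((hg.cubic_dvd_iff hT hdeg hZ hS₁).1 hg₁) ((hg.cubic_dvd_iff hT hdeg hZ hS₂).1 hg₂)
  have hdeg₁ : h₁ = h₂.neg → (sPoly A B h₁ h₂).2 = 0 ∧ (sPoly A B h₁ h₂).1.natDegree ≤ 3 := by
    rintro rfl; exact sPoly_neg _
  have hdeg₂ : k₁ = k₂.neg → (sPoly A B k₁ k₂).2 = 0 ∧ (sPoly A B k₁ k₂).1.natDegree ≤ 3 := by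
    rintro rfl; exact sPoly_neg _
  have hgen₁ : h₁ ≠ h₂.neg → IsGeneric (sPoly A B h₁ h₂) := hh₁.isGeneric_sPoly hT hQ
  have hgen₂ : k₁ ≠ k₂.neg → IsGeneric (sPoly A B k₁ k₂) := hk₁.isGeneric_sPoly hT hQ'
  have hf₁ := hS₁.hasCubicFactors hT hdeg hQ hR
  have hf₂ := hS₂.hasCubicFactors hT hdeg hQ' hR'
  have h0₁ := hS₁.ne_zero
  have h0₂ := hS₂.ne_zero
  generalize sPoly A B h₁ h₂ = S₁ at *
  generalize sPoly A B k₁ k₂ = S₂ at *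
  by_cases hc₃ : h₁ = h₂.neg
  · simp only [if_pos hc₃]
    obtain ⟨e, hd⟩ := hdeg₁ hc₃
    refine solve_linSys_monicOf hV hirr e hd (fun e' => h0₁ (Prod.ext e' e)) ?_ hmem hneg hd₁ hd₂
      hcommon
    by_cases hc₄ : k₁ = k₂.neg
    exacts [.inl (hdeg₂ hc₄).1, .inr (hgen₂ hc₄)]
  by_cases hc₄ : k₁ = k₂.neg
  · simp only [if_neg hc₃, if_pos hc₄]
    obtain ⟨e, hd⟩ := hdeg₂ hc₄
    exact solve_linSys_monicOf hV hirr e hd (fun e' => h0₂ (Prod.ext e' e)) (.inr (hgen₁ hc₃))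
      hmem hneg hd₂ hd₁ fun g hg hg₂ hg₁ => hcommon g hg hg₁ hg₂
  simp only [if_neg hc₃, if_neg hc₄]
  have hG₁ := hgen₁ hc₃
  classical
  have hG : EuclideanDomain.gcd (sigma A B S₁) (sigma A B S₂) ≠ 0 := fun e =>
    hG₁.sigma_ne_zero (EuclideanDomain.gcd_eq_zero_iff.1 e).1
  refine factorLoop_eq_some hV hirr hG₁ (hgen₂ hc₄) hf₁ hf₂ hmem hneg hd₁ hd₂ hcommon _ ?_ ?_
  · intro W hW
    rw [horder, mem_cubicFactors_iff hG] at hW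
    exact ⟨hW.1, hW.2.1, hW.2.2.1.trans (EuclideanDomain.gcd_dvd_left _ _),
      hW.2.2.1.trans (EuclideanDomain.gcd_dvd_right _ _)⟩
  · rw [horder, mem_cubicFactors_iff hG]
    exact ⟨h.cubic_monic, hirr h hmem, EuclideanDomain.dvd_gcd (Line.cubic_dvd_sigma hd₁)
      (Line.cubic_dvd_sigma hd₂), h.natDegree_cubic⟩

end

end

end TraceZero

theorem mainTheorem4
    {F L : Type*} [Field F] [Fintype F] [Field L] [Algebra F L] [DecidableEq L]
    (hchar2 : ringChar F ≠ 2) (hchar3 : ringChar F ≠ 3)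
    (hdeg : Module.finrank F L = 3)
    (A B : F) (hf : (TraceZero.cubic A B).Separable)
    -- the trace-zero subgroup is cyclic of prime order `p > 3`, generated by `P`
    (p : ℕ) (hp : p.Prime) (hp3 : 3 < p)
    (P : ((TraceZero.curve A B)⁄L).Point)
    (hgen : TraceZero.traceZero L A B = AddSubgroup.zmultiples P)
    (hcard : Nat.card (TraceZero.traceZero L A B) = p)
    (m m₁ m₂ n₁ n₂ : ℤ) (hm0 : 0 < m) (hmp : m < p) (hodd : Odd m)
    (hm : m₁ + m₂ = m) (hn : n₁ + n₂ = m)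
    -- automatic when `m₁, m₂, n₁, n₂` are positive
    (hmne : m₁ • P ≠ m₂ • P) (hnne : n₁ • P ≠ n₂ • P)
    -- the input lines
    (h₁ h₂ k₁ k₂ : TraceZero.Line F)
    (hh₁ : TraceZero.IsLineOf h₁ (m₁ • P)) (hh₂ : TraceZero.IsLineOf h₂ (m₂ • P))
    (hk₁ : TraceZero.IsLineOf k₁ (n₁ • P)) (hk₂ : TraceZero.IsLineOf k₂ (n₂ • P))
    -- none of the lines of `m₁P + φⁱ(m₂P)` is one of the lines of `n₁P + φʲ(n₂P)`, for `i, j = 1, 2`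
    (hgeneric : ∀ i ∈ ({1, 2} : Set ℕ), ∀ j ∈ ({1, 2} : Set ℕ), ∀ h k : TraceZero.Line F,
      TraceZero.IsLineOf h (m₁ • P + (TraceZero.frob A B)^[i] (m₂ • P)) →
      TraceZero.IsLineOf k (n₁ • P + (TraceZero.frob A B)^[j] (n₂ • P)) → h ≠ k)
    -- any order of the cubic factors in the loop
    (order : Finset F[X] → List F[X])
    (horder : ∀ s : Finset F[X], (order s).Nodup ∧ ∀ W, W ∈ order s ↔ W ∈ s) :
    -- the polynomials computed from the lines are `S_{m₁P, m₂P}` and `S_{n₁P, n₂P}`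
    (h₁ ≠ h₂ → TraceZero.IsS (TraceZero.sPoly A B h₁ h₂) (m₁ • P) (m₂ • P)) ∧
    (k₁ ≠ k₂ → TraceZero.IsS (TraceZero.sPoly A B k₁ k₂) (n₁ • P) (n₂ • P)) ∧
    -- the line of `mP` exists, is unique, and is returned
    ∃ h : TraceZero.Line F, TraceZero.IsLineOf h (m • P) ∧
      (∀ h', TraceZero.IsLineOf h' (m • P) → h' = h) ∧
      TraceZero.subalgorithm A B order h₁ h₂ k₁ k₂ = some h := by
  have h2 : (2 : F) ≠ 0 := Ring.two_ne_zero hchar2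
  have hT := TraceZero.noTwoThreeTorsion_of_card hp hp3 hcard
  have hmem : ∀ n : ℤ, n • P ∈ TraceZero.traceZero L A B := fun n => by
    rw [hgen]
    exact AddSubgroup.zsmul_mem_zmultiples P n
  -- The order of `P` is `p`, and `0 < m < p`.
  have hM : m • P ≠ 0 := fun e => by
    rw [hgen, Nat.card_zmultiples] at hcard
    have := addOrderOf_dvd_iff_zsmul_eq_zero.2 e
    rw [hcard] at this
    exact absurd (Int.le_of_dvd hm0 this) (not_le.2 hmp)
  have e₁ : m₁ • P + m₂ • P = m • P := by rw [← add_zsmul, hm]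
  have e₂ : n₁ • P + n₂ • P = m • P := by rw [← add_zsmul, hn]
  obtain ⟨h, hh⟩ := TraceZero.exists_isLineOf hT (hmem m) hM
  exact ⟨hh₁.isS_sPoly hT h2 hh₂ (hmem m₁) (hmem m₂), hk₁.isS_sPoly hT h2 hk₂ (hmem n₁) (hmem n₂),
    h, hh, fun h' hh' => hh'.unique hT hh (hmem m),
    TraceZero.subalgorithm_eq_some hT h2 hdeg (hmem m₁) (hmem m₂) (hmem n₁) (hmem n₂)
      (e₁.trans e₂.symm) hmne hnne hh₁ hh₂ hk₁ hk₂ (e₁.symm ▸ hh) hgeneric order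
      fun s => (horder s).2⟩
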